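/- For every $k<\omega$ and every $\Sigma_1$-formula $\varphi(v_0,\ldots,v_{k-1})$ in the language of set theory (a block of existential quantifiers followed by a formula all of whose quantifiers are bounded), there exists a $\Sigma^1_2$-formula $\psi(w_0,\ldots,w_{k-1})$ in the language of set theory with free second-order variables $w_0,\ldots,w_{k-1}$ (a formula $\exists X\,\forall Y\,\chi$, where $X,Y$ are second-order variables and all quantifiers of $\chi$ are first-order) such that $\mathrm{ZFC}$ proves the following statement: for every singular cardinal $\lambda$ of countable cofinality with $H(\lambda)=V_\lambda$ and all $A_0,\ldots,A_{k-1}\in V_{\lambda+1}$, $$\varphi(A_0,\ldots,A_{k-1})\quad\Longleftrightarrow\quad\langle V_\lambda,\in\rangle\models\psi(A_0,\ldots,A_{k-1}).$$ Here $H(\lambda)$ is the set of all sets whose transitive closure has cardinality less than $\lambda$, and in $\langle V_\lambda,\in\rangle\models\psi(A_0,\ldots,A_{k-1})$ first-order variables range over elements of $V_\lambda$ and second-order variables over subsets of $V_\lambda$. -/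

import Mathlib

open FirstOrder

namespace LST

/-! ### The language of set theory -/

/-- The only non-logical symbol of the language of set theory is the binary relation symbol `∈`. -/
inductive SetRel : ℕ → Type
  | mem : SetRel 2

/-- The first-order language of set theory. -/
def setLang : Language := ⟨fun _ => Empty, SetRel⟩

/-- Formulas of the language of set theory whose free variables are among `v₀, …, vₙ₋₁`.
A quantifier in front of a formula with variables `v₀, …, vₙ` binds the last one, `vₙ`. -/
abbrev Fm (n : ℕ) : Type := setLang.BoundedFormula Empty n

/-- A variable among `v₀, …, vₙ₋₁`, seen as one among `v₀, …, vₙ`. -/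
postfix:max "↗" => Fin.castSucc

variable {m n : ℕ}

/-- `f 0, …, f (m-1), x`. -/
def push (f : Fin m → Fin n) (x : Fin n) : Fin (m + 1) → Fin n :=
  Fin.snoc (α := fun _ => Fin n) f x

/-- Simultaneous renaming of the free variables along `f` (bound variables are renamed so that
nothing is captured). -/
def rename {m : ℕ} : Fm m → {n : ℕ} → (Fin m → Fin n) → Fm n
  | .falsum, _, _ => .falsum
  | .equal s t, _, f => .equal (s.relabel (Sum.map id f)) (t.relabel (Sum.map id f))
  | .rel R ts, _, f => .rel R fun i => (ts i).relabel (Sum.map id f)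
  | .imp φ ψ, _, f => .imp (rename φ f) (rename ψ f)
  | .all φ, n, f => .all (rename φ (push (fun i => (f i)↗) (Fin.last n)))

def mem (x y : Fin n) : Fm n :=
  Language.BoundedFormula.rel SetRel.mem ![.var (.inr x), .var (.inr y)]

def eq (x y : Fin n) : Fm n :=
  Language.BoundedFormula.equal (.var (.inr x)) (.var (.inr y))

/-- `∀ z, f z` -/
def allF (f : Fin (n + 1) → Fm (n + 1)) : Fm n := (f (Fin.last n)).all

/-- `∃ z, f z` -/
def exF (f : Fin (n + 1) → Fm (n + 1)) : Fm n := (f (Fin.last n)).ex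

/-- `∀ z ∈ x, f z` -/
def ballF (x : Fin n) (f : Fin (n + 1) → Fm (n + 1)) : Fm n := allF fun z => mem z x↗ ⟹ f z

/-- `∃ z ∈ x, f z` -/
def bexF (x : Fin n) (f : Fin (n + 1) → Fm (n + 1)) : Fm n := exF fun z => mem z x↗ ⊓ f z

/-! ### Provability -/

/-- First-order provability (natural deduction for classical logic with equality):
`Proves Γ φ` says that the formula `φ` in the variables `v₀, …, vₙ₋₁` is derivable from the
assumptions `Γ` in the same variables. As the language has no function symbols, the terms are
exactly the variables. -/
inductive Proves : {n : ℕ} → Set (Fm n) → Fm n → Prop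
  | assumption {n : ℕ} {Γ : Set (Fm n)} {φ : Fm n} : φ ∈ Γ → Proves Γ φ
  | impIntro {n : ℕ} {Γ : Set (Fm n)} {φ ψ : Fm n} :
      Proves (insert φ Γ) ψ → Proves Γ (φ ⟹ ψ)
  | impElim {n : ℕ} {Γ : Set (Fm n)} {φ ψ : Fm n} :
      Proves Γ (φ ⟹ ψ) → Proves Γ φ → Proves Γ ψ
  | byContra {n : ℕ} {Γ : Set (Fm n)} {φ : Fm n} :
      Proves (insert (∼φ) Γ) ⊥ → Proves Γ φ
  | allIntro {n : ℕ} {Γ : Set (Fm n)} {φ : Fm (n + 1)} :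
      Proves ((fun γ => rename γ Fin.castSucc) '' Γ) φ → Proves Γ φ.all
  | allElim {n : ℕ} {Γ : Set (Fm n)} {φ : Fm (n + 1)} (x : Fin n) :
      Proves Γ φ.all → Proves Γ (rename φ (push id x))
  | eqRefl {n : ℕ} {Γ : Set (Fm n)} (x : Fin n) : Proves Γ (eq x x)
  | eqSubst {n : ℕ} {Γ : Set (Fm n)} {φ : Fm (n + 1)} {x y : Fin n} :
      Proves Γ (eq x y) → Proves Γ (rename φ (push id x)) → Proves Γ (rename φ (push id y))

/-! ### Basic set-theoretic formulas -/

/-- `x ⊆ y` -/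
def subset (x y : Fin n) : Fm n := ballF x fun z => mem z y↗

/-- `x` is empty -/
def isEmpty (x : Fin n) : Fm n := allF fun z => ∼(mem z x↗)

/-- `z = {x, y}` -/
def isPair (z x y : Fin n) : Fm n := allF fun u => mem u z↗ ⇔ (eq u x↗ ⊔ eq u y↗)

/-- `y = x ∪ {x}` -/
def isSucc (y x : Fin n) : Fm n := allF fun z => mem z y↗ ⇔ (mem z x↗ ⊔ eq z x↗)

/-- `p` is the ordered pair `(x, y) = {{x}, {x, y}}` -/
def isOPair (p x y : Fin n) : Fm n :=
  allF fun z => mem z p↗ ⇔ (isPair z x↗ x↗ ⊔ isPair z x↗ y↗)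

/-- `(x, y) ∈ f` -/
def pairMem (f x y : Fin n) : Fm n := bexF f fun p => isOPair p x↗ y↗

/-! ### The axioms of ZFC -/

def extensionality : setLang.Sentence :=
  allF fun x => allF fun y => (allF fun z => mem z x↗↗ ⇔ mem z y↗) ⟹ eq x↗ y

def foundation : setLang.Sentence :=
  allF fun x => (exF fun y => mem y x↗) ⟹ bexF x fun y => ballF x↗ fun z => ∼(mem z y↗)

def pairing : setLang.Sentence :=
  allF fun x => allF fun y => exF fun z => isPair z x↗↗ y↗

def union : setLang.Sentence :=
  allF fun x => exF fun u => allF fun z => mem z u↗ ⇔ bexF x↗↗ fun y => mem z↗ y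

def powerSet : setLang.Sentence :=
  allF fun x => exF fun p => allF fun z => mem z p↗ ⇔ subset z x↗↗

def infinity : setLang.Sentence :=
  exF fun x => (bexF x fun e => isEmpty e) ⊓ ballF x fun y => bexF x↗ fun s => isSucc s y↗

/-- Every family of pairwise disjoint nonempty sets has a transversal. -/
def choice : setLang.Sentence :=
  allF fun F =>
    ((ballF F fun x => exF fun y => mem y x↗) ⊓
      (ballF F fun x => ballF F↗ fun y => (exF fun z => mem z x↗↗ ⊓ mem z y↗) ⟹ eq x↗ y)) ⟹
    exF fun c => ballF F↗ fun x => exF fun z => allF fun u =>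
      (mem u x↗↗ ⊓ mem u c↗↗↗) ⇔ eq u z↗

/-- Separation for `φ(p₀, …, pₙ₋₁, x)`:
`∀ p ∀ a ∃ b ∀ x (x ∈ b ↔ x ∈ a ∧ φ(p, x))`. -/
def separation (φ : Fm (n + 1)) : setLang.Sentence :=
  (allF fun a => exF fun b => allF fun x =>
    mem x b↗ ⇔ (mem x a↗↗ ⊓ rename φ (push (fun i => i↗↗↗) x)) : Fm n).alls

/-- Replacement for `φ(p₀, …, pₙ₋₁, x, y)`:
`∀ p (∀ x ∀ y ∀ z (φ(p, x, y) ∧ φ(p, x, z) → y = z) →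
  ∀ a ∃ b ∀ y (y ∈ b ↔ ∃ x ∈ a, φ(p, x, y)))`. -/
def replacement (φ : Fm (n + 2)) : setLang.Sentence :=
  ((allF fun x => allF fun y => allF fun z =>
      (rename φ (push (push (fun i => i↗↗↗) x↗↗) y↗) ⊓
        rename φ (push (push (fun i => i↗↗↗) x↗↗) z)) ⟹ eq y↗ z) ⟹
    (allF fun a => exF fun b => allF fun y =>
      mem y b↗ ⇔ bexF a↗↗ fun x => rename φ (push (push (fun i => i↗↗↗↗) x) y↗)) : Fm n).alls

/-- Zermelo–Fraenkel set theory with the axiom of choice. -/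
def ZFC : setLang.Theory :=
  {extensionality, foundation, pairing, union, powerSet, infinity, choice} ∪
    {σ | ∃ (n : ℕ) (φ : Fm (n + 1)), σ = separation φ} ∪
    {σ | ∃ (n : ℕ) (φ : Fm (n + 2)), σ = replacement φ}

/-! ### `Σ₁`-formulas -/

/-- `Δ₀`-formulas: all quantifiers are bounded. -/
inductive IsDelta0 : {n : ℕ} → Fm n → Prop
  | falsum {n : ℕ} : IsDelta0 (⊥ : Fm n)
  | mem {n : ℕ} (x y : Fin n) : IsDelta0 (mem x y)
  | eq {n : ℕ} (x y : Fin n) : IsDelta0 (eq x y)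
  | imp {n : ℕ} {φ ψ : Fm n} : IsDelta0 φ → IsDelta0 ψ → IsDelta0 (φ ⟹ ψ)
  | ball {n : ℕ} (x : Fin n) {φ : Fm (n + 1)} : IsDelta0 φ → IsDelta0 (ballF x fun _ => φ)
  | bex {n : ℕ} (x : Fin n) {φ : Fm (n + 1)} : IsDelta0 φ → IsDelta0 (bexF x fun _ => φ)

/-- `Σ₁`-formulas of the Levy hierarchy: a block of existential quantifiers in front of a
`Δ₀`-formula. -/
inductive IsSigma1 : {n : ℕ} → Fm n → Prop
  | delta0 {n : ℕ} {φ : Fm n} : IsDelta0 φ → IsSigma1 φ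
  | ex {n : ℕ} {φ : Fm (n + 1)} : IsSigma1 φ → IsSigma1 φ.ex

/-! ### Second-order formulas -/

/-- Second-order formulas of the language of set theory with free second-order variables among
`w₀, …, wₘ₋₁` and free first-order variables among `v₀, …, vₙ₋₁`. Second-order variables range
over subsets of the domain. -/
inductive SOFm : ℕ → ℕ → Type
  | falsum {m n : ℕ} : SOFm m n
  | mem {m n : ℕ} (x y : Fin n) : SOFm m n
  | eq {m n : ℕ} (x y : Fin n) : SOFm m n
  /-- the element `x` belongs to the set `X` -/
  | app {m n : ℕ} (X : Fin m) (x : Fin n) : SOFm m n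
  | imp {m n : ℕ} (φ ψ : SOFm m n) : SOFm m n
  | all₁ {m n : ℕ} (φ : SOFm m (n + 1)) : SOFm m n
  | all₂ {m n : ℕ} (φ : SOFm (m + 1) n) : SOFm m n

/-- `∃ X, φ` for a second-order variable `X` -/
def SOFm.ex₂ (φ : SOFm (m + 1) n) : SOFm m n := .imp (.all₂ (.imp φ .falsum)) .falsum

/-- No second-order quantifiers occur. -/
inductive SOFm.NoSOQuant : {m n : ℕ} → SOFm m n → Prop
  | falsum {m n : ℕ} : NoSOQuant (.falsum : SOFm m n)
  | mem {m n : ℕ} (x y : Fin n) : NoSOQuant (.mem x y : SOFm m n)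
  | eq {m n : ℕ} (x y : Fin n) : NoSOQuant (.eq x y : SOFm m n)
  | app {m n : ℕ} (X : Fin m) (x : Fin n) : NoSOQuant (.app X x : SOFm m n)
  | imp {m n : ℕ} {φ ψ : SOFm m n} : NoSOQuant φ → NoSOQuant ψ → NoSOQuant (.imp φ ψ)
  | all₁ {m n : ℕ} {φ : SOFm m (n + 1)} : NoSOQuant φ → NoSOQuant (.all₁ φ)

/-- `Σ¹₂`-formulas: `∃ X ∀ Y χ` with second-order variables `X`, `Y`, where `χ` has only
first-order quantifiers. -/
def SOFm.IsSigma12 (ψ : SOFm m n) : Prop :=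
  ∃ χ : SOFm (m + 2) n, χ.NoSOQuant ∧ ψ = .ex₂ (.all₂ χ)

/-- The formula of set theory `⟨D, ∈⟩ ⊨ ψ(A; a)`, for a fixed second-order formula `ψ`: first-order
quantifiers range over the elements of `D`, second-order quantifiers over the subsets of `D`. -/
def SOFm.sat : {m n : ℕ} → SOFm m n → {N : ℕ} → (D : Fin N) → (A : Fin m → Fin N) →
    (a : Fin n → Fin N) → Fm N
  | _, _, .falsum, _, _, _, _ => ⊥
  | _, _, .mem x y, _, _, _, a => LST.mem (a x) (a y)
  | _, _, .eq x y, _, _, _, a => LST.eq (a x) (a y)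
  | _, _, .app X x, _, _, A, a => LST.mem (a x) (A X)
  | _, _, .imp φ ψ, _, D, A, a => φ.sat D A a ⟹ ψ.sat D A a
  | _, _, .all₁ φ, _, D, A, a =>
      allF fun x => LST.mem x D↗ ⟹ φ.sat D↗ (fun i => (A i)↗) (push (fun i => (a i)↗) x)
  | _, _, .all₂ φ, _, D, A, a =>
      allF fun X => subset X D↗ ⟹ φ.sat D↗ (push (fun i => (A i)↗) X) (fun i => (a i)↗)

/-! ### Ordinals, cardinals, `V_λ` and `H(λ)` -/

/-- `f` is a function from `x` to `y` -/
def isFun (f x y : Fin n) : Fm n :=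
  (ballF f fun p => bexF x↗ fun a => bexF y↗↗ fun b => isOPair p↗↗ a↗ b) ⊓
    (ballF x fun a => exF fun b => allF fun c => pairMem f↗↗↗ a↗↗ c ⇔ eq c b↗)

/-- `f` is a bijection from `x` to `y` -/
def isBij (f x y : Fin n) : Fm n :=
  isFun f x y ⊓
    (ballF y fun b => exF fun a => allF fun c => pairMem f↗↗↗ c b↗↗ ⇔ eq c a↗)

/-- There is a bijection from `x` to `y`. -/
def equinumerous (x y : Fin n) : Fm n := exF fun f => isBij f x↗ y↗

/-- `x` is a transitive set -/
def isTransitive (x : Fin n) : Fm n := ballF x fun y => subset y x↗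

/-- `x` is an ordinal: a transitive set linearly ordered (hence, by foundation, well-ordered)
by `∈` -/
def isOrd (x : Fin n) : Fm n :=
  isTransitive x ⊓ ballF x fun y => ballF x↗ fun z => mem y↗ z ⊔ (eq y↗ z ⊔ mem z y↗)

/-- `x` is a nonzero limit ordinal -/
def isLimit (x : Fin n) : Fm n :=
  isOrd x ⊓ ((exF fun y => mem y x↗) ⊓ ballF x fun y => bexF x↗ fun z => mem y↗ z)

/-- `w = ω` -/
def isOmega (w : Fin n) : Fm n := isLimit w ⊓ ballF w fun y => ∼(isLimit y)

/-- `l` is an infinite cardinal: an ordinal `≥ ω` that is not equinumerous to a smaller one -/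
def isInfCard (l : Fin n) : Fm n :=
  isOrd l ⊓ ((exF fun w => isOmega w ⊓ subset w l↗) ⊓ ballF l fun b => ∼(equinumerous b l↗))

/-- There is a function from `x` to the ordinal `l` with cofinal range. -/
def hasCofinalMap (x l : Fin n) : Fm n :=
  exF fun f => isFun f x↗ l↗ ⊓
    ballF l↗ fun b => bexF x↗↗ fun a => bexF l↗↗↗ fun c =>
      pairMem f↗↗↗ a↗ c ⊓ subset b↗↗ c

/-- `c` is the cofinality of the ordinal `l` -/
def isCof (c l : Fin n) : Fm n :=
  isOrd c ⊓ (hasCofinalMap c l ⊓ ballF c fun b => ∼(hasCofinalMap b l↗))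

/-- `l` is a singular cardinal -/
def isSingular (l : Fin n) : Fm n := isInfCard l ⊓ bexF l fun c => isCof c l↗

/-- `l` has countable cofinality, i.e. cofinality `ω` -/
def hasCofOmega (l : Fin n) : Fm n := exF fun w => isOmega w ⊓ isCof w l↗

/-- `D = V_l` for the ordinal `l`, where `V_α = ⋃_{β < α} 𝒫(V_β)`: there is a function `f` with
domain `l` such that `f(α) = ⋃_{β < α} 𝒫(f(β))` for all `α < l`, and `D = ⋃_{β < l} 𝒫(f(β))`. -/
def isV (D l : Fin n) : Fm n :=
  exF fun f => (exF fun r => isFun f↗ l↗↗ r) ⊓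
    ((ballF l↗ fun a => exF fun u => pairMem f↗↗ a↗ u ⊓
        allF fun x => mem x u↗ ⇔
          bexF a↗↗ fun b => exF fun v => pairMem f↗↗↗↗↗ b↗ v ⊓ subset x↗↗ v) ⊓
      (allF fun x => mem x D↗↗ ⇔
        bexF l↗↗ fun b => exF fun v => pairMem f↗↗↗ b↗ v ⊓ subset x↗↗ v))

/-- `t` is the transitive closure of `x` -/
def isTrCl (t x : Fin n) : Fm n :=
  (subset x t ⊓ isTransitive t) ⊓
    allF fun s => (subset x↗ s ⊓ isTransitive s) ⟹ subset t↗ s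

/-- `D = H(l)` for the infinite cardinal `l`: the elements of `D` are the sets whose transitive
closure has cardinality less than `l`, i.e. is equinumerous to some ordinal below `l` -/
def isH (D l : Fin n) : Fm n :=
  allF fun x => mem x D↗ ⇔ exF fun t => isTrCl t x↗ ⊓ bexF l↗↗ fun b => equinumerous t↗ b

/-- The sentence
`∀ A₀ … Aₖ₋₁ ∀ l ∀ D, l` is a singular cardinal of countable cofinality, `D = V_l`, `H(l) = V_l`
and `A₀, …, Aₖ₋₁ ∈ 𝒫(V_l) = V_{l+1}` imply `φ(A₀, …, Aₖ₋₁) ↔ ⟨V_l, ∈⟩ ⊨ ψ(A₀, …, Aₖ₋₁)`. -/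
noncomputable def translationSentence {k : ℕ} (φ : Fm k) (ψ : SOFm k 0) : setLang.Sentence :=
  (allF fun l => allF fun D =>
    ((isSingular l↗ ⊓ hasCofOmega l↗) ⊓ ((isV D l↗ ⊓ isH D l↗) ⊓
      Language.BoundedFormula.iInf fun i : Fin k => subset i↗↗ D)) ⟹
    (rename φ (fun i => i↗↗) ⇔ ψ.sat D (fun i => i↗↗) Fin.elim0) : Fm k).alls

end LST

namespace LST

/-! ### Renaming of variables -/

/-! By the completeness theorem `Proves.of_models` it suffices to work in an arbitrary model of ZFC.
Let `V = V_λ` there. The formula `ψ` says that some `X ⊆ V`, read as a binary relation on `V`, codes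
a transitive structure in which `φ(A₀, …, Aₖ₋₁)` holds. In detail: `X` is well-founded (every `Y ⊆
V` that is nonempty has an `X`-minimal element); the relation respects the equivalence "same
predecessors", which interprets equality; the pair `(∅, x)` is a code of `x` for each `x ∈ V`; and
some `aᵢ ∈ V` are codes of the `Aᵢ` for which `φ` holds in `(V, X)`. Since `V` is transitive and
closed under pairs, everything except the quantifiers over `X` and `Y` is first-order over `V`, so
`ψ` has the form `∃ X ∀ Y`.

If such an `X` exists, its Mostowski collapse (`IsCoding.exists_collapse`) maps `V` onto a
transitive class, `aᵢ` goes to `Aᵢ`, and `φ(A)` is true by upward absoluteness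
(`IsCoding.realize_of_sat`).

Conversely let `φ(A)` be true. Choose a transitive pair-closed set `W` that contains `V`, the `Aᵢ`
and witnesses for the existential block. A Skolem hull of `V` inside `W` is closed under the
finitely many Tarski–Vaught instances that matter. These come from a `Δ₀`-formula, so they hold for
every transitive class and no reflection principle is required. The hull is enumerated by `V`
itself, whose elements are read as terms (`IsPairClosed.exists_enumeration`); this replaces cardinal
arithmetic. Pulling `∈` back along the enumeration yields `X` (`IsPairClosed.exists_coding`).

Countable cofinality makes `λ` a limit ordinal, hence `V` pair-closed, and supplies `ω` for the
iteration that builds `W`.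

Inside a model, sets can be formed only from definable predicates and functions. The classes `Df`
and `DfF` let instance search verify definability. -/

theorem term_eq_var {n : ℕ} (t : setLang.Term (Empty ⊕ Fin n)) : ∃ x, t = .var (.inr x) := by
  match t with
  | .var (.inl x) => exact x.elim
  | .var (.inr x) => exact ⟨x, rfl⟩
  | .func f _ => exact (f : Empty).elim

/-- Induction on formulas, where the atomic formulas are `x = y` and `x ∈ y`. -/
theorem Fm.induction {P : ∀ {n : ℕ}, Fm n → Prop} (falsum : ∀ {n}, P (⊥ : Fm n))
    (eq : ∀ {n} (x y : Fin n), P (eq x y)) (mem : ∀ {n} (x y : Fin n), P (mem x y))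
    (imp : ∀ {n} (φ ψ : Fm n), P φ → P ψ → P (φ ⟹ ψ))
    (all : ∀ {n} (φ : Fm (n + 1)), P φ → P φ.all) {n : ℕ} (φ : Fm n) : P φ := by
  induction φ with
  | falsum => exact falsum
  | equal s t =>
    obtain ⟨x, rfl⟩ := term_eq_var s
    obtain ⟨y, rfl⟩ := term_eq_var t
    exact eq x y
  | @rel n _ R ts =>
    cases R
    obtain ⟨x, hx⟩ := term_eq_var (ts 0)
    obtain ⟨y, hy⟩ := term_eq_var (ts 1)
    have : ts = ![.var (.inr x), .var (.inr y)] := by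
      funext i
      fin_cases i
      · exact hx
      · exact hy
    rw [this]
    exact mem x y
  | imp φ ψ h1 h2 => exact imp φ ψ h1 h2
  | all φ h => exact all φ h

variable {m n k : ℕ}

theorem rename_eq (x y : Fin m) (f : Fin m → Fin n) : rename (eq x y) f = eq (f x) (f y) := rfl

theorem rename_mem (x y : Fin m) (f : Fin m → Fin n) : rename (mem x y) f = mem (f x) (f y) := by
  simp only [mem, rename]
  congr 1
  funext i
  fin_cases i <;> rfl

theorem rename_imp (φ ψ : Fm m) (f : Fin m → Fin n) :
    rename (φ ⟹ ψ) f = (rename φ f ⟹ rename ψ f) := rfl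

theorem rename_all (φ : Fm (m + 1)) (f : Fin m → Fin n) :
    rename φ.all f = (rename φ (push (fun i => (f i)↗) (Fin.last n))).all := rfl

theorem push_castSucc (f : Fin m → Fin n) (x : Fin n) (i : Fin m) : push f x i.castSucc = f i :=
  Fin.snoc_castSucc (α := fun _ => Fin n) x f i

theorem push_last (f : Fin m → Fin n) (x : Fin n) : push f x (Fin.last m) = x :=
  Fin.snoc_last (α := fun _ => Fin n) x f

theorem rename_rename (φ : Fm m) : ∀ {n k : ℕ} (f : Fin m → Fin n) (g : Fin n → Fin k),
    rename (rename φ f) g = rename φ (fun i => g (f i)) := by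
  induction φ using Fm.induction with
  | falsum => intros; rfl
  | eq x y => intros; rfl
  | mem x y => intros; simp only [rename_mem]
  | imp φ ψ h1 h2 => intros; simp only [rename_imp, h1, h2]
  | all φ h =>
    intro n k f g
    simp only [rename_all, h]
    congr 2
    funext i
    refine Fin.lastCases ?_ (fun i => ?_) i <;> simp only [push_last, push_castSucc]

theorem rename_id (φ : Fm m) : rename φ (fun i => i) = φ := by
  induction φ using Fm.induction with
  | falsum => rfl
  | eq x y => rfl
  | mem x y => rw [rename_mem]
  | imp φ ψ h1 h2 => rw [rename_imp, h1, h2]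
  | @all k φ h =>
    rw [rename_all]
    have : push (fun i : Fin k => i↗) (Fin.last k) = fun i => i := by
      funext i
      refine Fin.lastCases ?_ (fun i => ?_) i <;> simp only [push_last, push_castSucc]
    rw [this, h]

/-! ### Derivations -/

theorem Proves.weaken {Γ Δ : Set (Fm n)} {φ : Fm n} (h : Proves Γ φ) (hs : Γ ⊆ Δ) :
    Proves Δ φ := by
  induction h with
  | assumption h => exact .assumption (hs h)
  | impIntro _ ih => exact .impIntro (ih (Set.insert_subset_insert hs))
  | impElim _ _ ih1 ih2 => exact .impElim (ih1 hs) (ih2 hs)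
  | byContra _ ih => exact .byContra (ih (Set.insert_subset_insert hs))
  | allIntro _ ih => exact .allIntro (ih (Set.image_mono hs))
  | allElim x _ ih => exact .allElim x (ih hs)
  | eqRefl x => exact .eqRefl x
  | eqSubst _ _ ih1 ih2 => exact .eqSubst (ih1 hs) (ih2 hs)

/-- A set of formulas is consistent if no contradiction is derivable from it. -/
def Consistent (Γ : Set (Fm n)) : Prop := ¬ Proves Γ ⊥

theorem Consistent.insert_or {Γ : Set (Fm n)} (h : Consistent Γ) (φ : Fm n) :
    Consistent (insert φ Γ) ∨ Consistent (insert (∼φ) Γ) := by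
  by_contra hc
  simp only [Consistent, not_or, not_not] at hc
  exact h (.impElim (.impIntro hc.1) (.byContra hc.2))

/-- A contradiction in one more variable can be generalised over it and then instantiated at
variable `0`, which exists because there is at least one variable. -/
theorem Consistent.lift {Γ : Set (Fm (n + 1))} (h : Consistent Γ) :
    Consistent ((fun γ => rename γ Fin.castSucc) '' Γ) := fun hc =>
  h (Proves.allElim 0 (.allIntro hc))

/-- Henkin's argument: the fresh last variable serves as the counterexample. Were it contradictory,
`φ` would be derivable for a fresh variable, and generalisation would refute `∼φ.all`. -/
theorem Consistent.insert_counterexample {Γ : Set (Fm n)} (h : Consistent Γ) {φ : Fm (n + 1)}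
    (hφ : (∼φ.all) ∈ Γ) :
    Consistent (insert (∼φ) ((fun γ => rename γ Fin.castSucc) '' Γ)) := fun hc =>
  h (.impElim (.assumption hφ) (.allIntro (.byContra hc)))

/-! ### Generic sequences of conditions and the Henkin model. -/

/-- A consistent set of formulas in finitely many (but at least one) variables. -/
structure Condition where
  /-- the number of variables, minus one -/
  vars : ℕ
  /-- the formulas -/
  forms : Set (Fm (vars + 1))
  consistent : Consistent forms

namespace Condition

instance : Preorder Condition where
  le p q := ∃ h : p.vars + 1 ≤ q.vars + 1, ∀ φ ∈ p.forms, rename φ (Fin.castLE h) ∈ q.forms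
  le_refl p := ⟨le_rfl, fun φ h => by
    have : (Fin.castLE (le_refl (p.vars + 1))) = fun i => i := rfl
    rwa [this, rename_id]⟩
  le_trans p q r := fun ⟨h1, h2⟩ ⟨h3, h4⟩ => ⟨h1.trans h3, fun φ hφ => by
    have := h4 _ (h2 φ hφ)
    rwa [rename_rename] at this⟩

/-- The condition `p` contains `φ(x_{v 0}, …, x_{v (m-1)})`. -/
def Contains (p : Condition) (φ : Fm m) (v : Fin m → ℕ) : Prop :=
  ∃ w : Fin m → Fin (p.vars + 1), (∀ i, (w i : ℕ) = v i) ∧ rename φ w ∈ p.forms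

theorem Contains.mono {p q : Condition} (h : p ≤ q) {φ : Fm m} {v : Fin m → ℕ}
    (hp : p.Contains φ v) : q.Contains φ v := by
  obtain ⟨h1, h2⟩ := h
  obtain ⟨w, hw, hφ⟩ := hp
  refine ⟨fun i => Fin.castLE h1 (w i), hw, ?_⟩
  have := h2 _ hφ
  rwa [rename_rename] at this

theorem exists_le_vars (p : Condition) (N : ℕ) : ∃ q, p ≤ q ∧ N ≤ q.vars := by
  induction N with
  | zero => exact ⟨p, le_rfl, Nat.zero_le _⟩
  | succ N ih =>
    obtain ⟨q, hq, hN⟩ := ih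
    refine ⟨⟨q.vars + 1, _, q.consistent.lift⟩, hq.trans ⟨by simp, fun φ hφ => ?_⟩, by simpa⟩
    exact ⟨φ, hφ, rfl⟩

theorem exists_le_contains (p : Condition) (φ : Fm m) (v : Fin m → ℕ) :
    ∃ q, p ≤ q ∧ (q.Contains φ v ∨ q.Contains (∼φ) v) := by
  -- The sum is a convenient common bound for all the indices `v i`.
  obtain ⟨q, hq, hN⟩ := p.exists_le_vars (∑ i, v i)
  have hv : ∀ i, v i < q.vars + 1 := fun i =>
    Nat.lt_succ_of_le
      ((Finset.single_le_sum (fun _ _ => Nat.zero_le _) (Finset.mem_univ i)).trans hN)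
  let w : Fin m → Fin (q.vars + 1) := fun i => ⟨v i, hv i⟩
  have key : ∀ ψ, ∀ h : Consistent (insert (rename ψ w) q.forms),
      p ≤ ⟨q.vars, _, h⟩ ∧ (⟨q.vars, _, h⟩ : Condition).Contains ψ v := fun ψ h => by
    refine ⟨hq.trans ⟨le_rfl, fun φ hφ => ?_⟩, w, fun _ => rfl, Set.mem_insert _ _⟩
    exact Set.mem_insert_of_mem _ ((rename_id φ).symm ▸ hφ)
  rcases q.consistent.insert_or (rename φ w) with h | h
  · exact ⟨_, (key φ h).1, .inl (key φ h).2⟩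
  · exact ⟨_, (key (∼φ) h).1, .inr (key (∼φ) h).2⟩

theorem exists_le_counterexample (p : Condition) (φ : Fm (m + 1)) (v : Fin m → ℕ)
    (h : p.Contains (∼φ.all) v) :
    ∃ q, p ≤ q ∧ ∃ i : ℕ, q.Contains (∼φ) (Fin.snoc (α := fun _ => ℕ) v i) := by
  obtain ⟨w, hw, hφ⟩ := h
  refine ⟨⟨p.vars + 1, _, p.consistent.insert_counterexample hφ⟩,
    ⟨by simp, fun φ hφ => Set.mem_insert_of_mem _ ⟨φ, hφ, rfl⟩⟩, p.vars + 1, push (fun i => (w i)↗)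
    (Fin.last _), fun i => ?_, Set.mem_insert _ _⟩
  refine Fin.lastCases ?_ (fun i => ?_) i
  · simp [push_last]
  · simp [push_castSucc, hw]

/-- The conditions that decide `φ(x_{v 0}, …)`, with an explicit counterexample if `φ` is a
universal formula that is refuted. -/
def deciding (φ : Fm m) (v : Fin m → ℕ) : Order.Cofinal Condition where
  carrier := {p | p.Contains φ v ∨ p.Contains (∼φ) v ∧ ∀ χ : Fm (m + 1), φ = χ.all →
    ∃ i : ℕ, p.Contains (∼χ) (Fin.snoc (α := fun _ => ℕ) v i)}
  isCofinal p := by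
    obtain ⟨q, hq, h | h⟩ := p.exists_le_contains φ v
    · exact ⟨q, .inl h, hq⟩
    · by_cases hχ : ∃ χ : Fm (m + 1), φ = χ.all
      · obtain ⟨χ, rfl⟩ := hχ
        obtain ⟨r, hr, i, hi⟩ := q.exists_le_counterexample χ v h
        refine ⟨r, .inr ⟨h.mono hr, fun χ' h' => ⟨i, ?_⟩⟩, hq.trans hr⟩
        cases h'
        exact hi
      · exact ⟨q, .inr ⟨h, fun χ h' => (hχ ⟨χ, h'⟩).elim⟩, hq⟩

end Condition

/-- Countability of the formulas allows a single generic ideal to meet all the cofinal sets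
`Condition.deciding φ v`. -/
instance : Countable setLang.Symbols := by
  have : Countable (Σ l, setLang.Functions l) :=
    ⟨fun x => (x.2 : Empty).elim, fun x => (x.2 : Empty).elim⟩
  have : Countable (Σ l, setLang.Relations l) :=
    ⟨fun _ => 0, by rintro ⟨_, ⟨⟩⟩ ⟨_, ⟨⟩⟩ _; rfl⟩
  unfold Language.Symbols
  infer_instance

instance (n : ℕ) : Countable (Fm n) :=
  (sigma_mk_injective (i := n) : Function.Injective
    (fun φ : Fm n => (⟨n, φ⟩ : Σ n, setLang.BoundedFormula Empty n))).countable

/-- A formula whose free variables are among countably many ones. -/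
abbrev InstFm : Type := Σ m : ℕ, Fm m × (Fin m → ℕ)

noncomputable instance : Encodable InstFm := Encodable.ofCountable _

/-- The set of formulas determined by a generic sequence of conditions extending `p`. -/
def GenericTruth (p : Condition) (φ : Fm m) (v : Fin m → ℕ) : Prop :=
  ∃ q ∈ Order.idealOfCofinals p (fun s : InstFm => Condition.deciding s.2.1 s.2.2), q.Contains φ v

namespace GenericTruth

open Condition

variable {p : Condition}

theorem or_not (p : Condition) (φ : Fm m) (v : Fin m → ℕ) :
    GenericTruth p φ v ∨ GenericTruth p (∼φ) v ∧ ∀ χ : Fm (m + 1), φ = χ.all →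
      ∃ i : ℕ, GenericTruth p (∼χ) (Fin.snoc (α := fun _ => ℕ) v i) := by
  obtain ⟨q, hq, hG⟩ := Order.cofinal_meets_idealOfCofinals p
    (fun s : InstFm => Condition.deciding s.2.1 s.2.2) ⟨m, φ, v⟩
  rcases hq with h | ⟨h, h'⟩
  · exact .inl ⟨q, hG, h⟩
  · exact .inr ⟨⟨q, hG, h⟩, fun χ hχ => (h' χ hχ).imp fun i hi => ⟨q, hG, hi⟩⟩

theorem of_forms {φ : Fm (p.vars + 1)} (h : φ ∈ p.forms) : GenericTruth p φ (fun i => i) :=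
  ⟨p, Order.mem_idealOfCofinals _ _, fun i => i, fun _ => rfl, by rwa [rename_id]⟩

theorem not_both {φ : Fm m} {v : Fin m → ℕ} (h : GenericTruth p φ v)
    (h' : GenericTruth p (∼φ) v) : False := by
  obtain ⟨q, hq, hφ⟩ := h
  obtain ⟨r, hr, hφ'⟩ := h'
  obtain ⟨t, -, hqt, hrt⟩ := Order.Ideal.directed _ q hq r hr
  obtain ⟨w, hw, h1⟩ := hφ.mono hqt
  obtain ⟨w', hw', h2⟩ := hφ'.mono hrt
  obtain rfl : w = w' := funext fun i => Fin.ext ((hw i).trans (hw' i).symm)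
  exact t.consistent (.impElim (.assumption h2) (.assumption h1))

/-- Generic truth is closed under derivations: otherwise `∼φ` occurs in the ideal, and a common
extension of three conditions is inconsistent. Derivability is demanded for all `N` because the
number of variables of that extension is not known in advance. -/
theorem of_proves {φ₁ : Fm m} {v₁ : Fin m → ℕ} {φ₂ : Fm n} {v₂ : Fin n → ℕ}
    (h₁ : GenericTruth p φ₁ v₁) (h₂ : GenericTruth p φ₂ v₂) {φ : Fm k} {v : Fin k → ℕ}
    (h : ∀ (N : ℕ) (w₁ : Fin m → Fin N) (w₂ : Fin n → Fin N) (w : Fin k → Fin N),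
      (∀ i, (w₁ i : ℕ) = v₁ i) → (∀ i, (w₂ i : ℕ) = v₂ i) → (∀ i, (w i : ℕ) = v i) →
      Proves {rename φ₁ w₁, rename φ₂ w₂} (rename φ w)) : GenericTruth p φ v := by
  refine (or_not p φ v).resolve_right fun ⟨⟨q, hq, hφ⟩, _⟩ => ?_
  obtain ⟨q₁, hq₁, hφ₁⟩ := h₁
  obtain ⟨q₂, hq₂, hφ₂⟩ := h₂
  obtain ⟨r, hr, h1, h2⟩ := Order.Ideal.directed _ q₁ hq₁ q₂ hq₂
  obtain ⟨t, -, h3, h4⟩ := Order.Ideal.directed _ r hr q hq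
  obtain ⟨w₁, hw₁, hf₁⟩ := hφ₁.mono (h1.trans h3)
  obtain ⟨w₂, hw₂, hf₂⟩ := hφ₂.mono (h2.trans h3)
  obtain ⟨w, hw, hf⟩ := hφ.mono h4
  refine t.consistent (.impElim (.assumption hf) ((h _ w₁ w₂ w hw₁ hw₂ hw).weaken ?_))
  rintro _ (rfl | rfl)
  · exact hf₁
  · exact hf₂

theorem not_iff {φ : Fm m} {v : Fin m → ℕ} : GenericTruth p (∼φ) v ↔ ¬ GenericTruth p φ v :=
  ⟨fun h h' => not_both h' h, fun h => ((or_not p φ v).resolve_left h).1⟩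

theorem not_bot {v : Fin m → ℕ} : ¬ GenericTruth p (⊥ : Fm m) v := by
  rintro ⟨q, -, w, -, h⟩
  exact q.consistent (.assumption h)

theorem imp_iff {φ ψ : Fm m} {v : Fin m → ℕ} :
    GenericTruth p (φ ⟹ ψ) v ↔ (GenericTruth p φ v → GenericTruth p ψ v) := by
  refine ⟨fun h h' => of_proves h h' fun N w₁ w₂ w h₁ h₂ h => ?_, fun h => ?_⟩
  · obtain rfl : w₁ = w := funext fun i => Fin.ext ((h₁ i).trans (h i).symm)
    obtain rfl : w₂ = w₁ := funext fun i => Fin.ext ((h₂ i).trans (h i).symm)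
    exact .impElim (.assumption (.inl rfl)) (.assumption (.inr rfl))
  · by_cases hφ : GenericTruth p φ v
    · refine of_proves (h hφ) (h hφ) fun N w₁ w₂ w h₁ h₂ h => ?_
      obtain rfl : w₁ = w := funext fun i => Fin.ext ((h₁ i).trans (h i).symm)
      exact .impIntro (.assumption (.inr (.inl rfl)))
    · rw [← not_iff] at hφ
      refine of_proves hφ hφ fun N w₁ w₂ w h₁ h₂ h => ?_
      obtain rfl : w₁ = w := funext fun i => Fin.ext ((h₁ i).trans (h i).symm)
      exact .impIntro (.byContra (.impElim (.assumption (.inr (.inr (.inl rfl))))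
        (.assumption (.inr (.inl rfl)))))

theorem eq_refl (i : ℕ) : GenericTruth p (eq 0 1 : Fm 2) ![i, i] := by
  -- Two trivial premises fill the slots of `of_proves`.
  refine of_proves (φ₁ := (∼⊥ : Fm 0)) (v₁ := ![]) (φ₂ := (∼⊥ : Fm 0)) (v₂ := ![])
    (not_iff.2 not_bot) (not_iff.2 not_bot) fun N _ _ w _ _ h => ?_
  have : w 0 = w 1 := Fin.ext ((h 0).trans (h 1).symm)
  rw [rename_eq, this]
  exact .eqRefl _

/-- The backward direction rests on the explicit counterexamples that the sets `deciding` enforce.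
-/
theorem all_iff {φ : Fm (m + 1)} {v : Fin m → ℕ} :
    GenericTruth p φ.all v ↔ ∀ i, GenericTruth p φ (Fin.snoc (α := fun _ => ℕ) v i) := by
  refine ⟨fun h i => of_proves h (eq_refl i) fun N w₁ w₂ w h₁ h₂ h => ?_, fun h => ?_⟩
  · have := Proves.allElim (w (Fin.last _))
      (.assumption (Set.mem_insert (rename φ.all w₁) {rename (eq 0 1) w₂}))
    rw [rename_rename] at this
    convert this with j
    refine Fin.lastCases ?_ (fun j => ?_) j
    · simp only [push_last]
    · simp only [push_castSucc, id]
      refine Fin.ext ((h _).trans ?_)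
      rw [Fin.snoc_castSucc, ← h₁]
  · by_contra hn
    obtain ⟨i, hi⟩ := ((or_not p φ.all v).resolve_left hn).2 φ rfl
    exact not_both (h i) hi

/-- Both instances of `φ` are brought into the shape of `Proves.eqSubst`: one formula with `N`
parameters whose extra last variable is replaced by one or the other side of the equation. -/
theorem subst {φ : Fm (m + 1)} {v : Fin m → ℕ} {i j : ℕ}
    (h : GenericTruth p (eq 0 1 : Fm 2) ![i, j])
    (hi : GenericTruth p φ (Fin.snoc (α := fun _ => ℕ) v i)) :
    GenericTruth p φ (Fin.snoc (α := fun _ => ℕ) v j) := by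
  refine of_proves h hi fun N w₁ w₂ w h₁ h₂ h => ?_
  have key : ∀ (u : Fin (m + 1) → Fin N) (x : Fin N), (x : ℕ) = u (Fin.last m) →
      (∀ l : Fin m, (u l↗ : ℕ) = w l↗) →
      rename φ u = rename (rename φ (push (fun l => (w l↗)↗) (Fin.last N))) (push id x) := by
    intro u x hx hu
    rw [rename_rename]
    congr 1
    funext l
    refine Fin.lastCases ?_ (fun l => ?_) l
    · simp only [push_last]
      exact Fin.ext hx.symm
    · simp only [push_castSucc, id]
      exact Fin.ext (hu l)
  have h1 := key w₂ (w₁ 0) (by rw [h₁, h₂]; simp) (fun l => by rw [h₂, h]; simp)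
  have h2 := key w (w₁ 1) (by rw [h₁, h]; simp) (fun l => rfl)
  rw [h2]
  refine .eqSubst (.assumption (.inl ?_)) (.assumption (.inr h1.symm))
  rw [rename_eq]

theorem mem_iff {x y : Fin m} {v : Fin m → ℕ} :
    GenericTruth p (mem x y) v ↔ GenericTruth p (mem 0 1 : Fm 2) ![v x, v y] := by
  constructor <;> refine fun h => of_proves h h fun N w₁ w₂ w h₁ h₂ h => .assumption (.inl ?_) <;>
    simp only [rename_mem]
  · congr 1 <;> apply Fin.ext <;> simp [h₁, h]
  · congr 1 <;> apply Fin.ext <;> simp [h₁, h]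

theorem eq_iff {x y : Fin m} {v : Fin m → ℕ} :
    GenericTruth p (eq x y) v ↔ GenericTruth p (eq 0 1 : Fm 2) ![v x, v y] := by
  constructor <;> refine fun h => of_proves h h fun N w₁ w₂ w h₁ h₂ h => .assumption (.inl ?_) <;>
    simp only [rename_eq]
  · congr 1 <;> apply Fin.ext <;> simp [h₁, h]
  · congr 1 <;> apply Fin.ext <;> simp [h₁, h]

/-- Generically true equality of variables. -/
def setoid (p : Condition) : Setoid ℕ where
  r i j := GenericTruth p (eq 0 1 : Fm 2) ![i, j]
  iseqv := by
    have symm : ∀ {i j}, GenericTruth p (eq 0 1 : Fm 2) ![i, j] →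
        GenericTruth p (eq 0 1 : Fm 2) ![j, i] := fun {i j} h => by
      have := subst (φ := (eq 1 0 : Fm 2)) (v := ![i]) h (eq_iff.2 (eq_refl i))
      exact eq_iff.1 this
    refine ⟨eq_refl, symm, fun {i j l} h h' => ?_⟩
    have := subst (φ := (eq 0 1 : Fm 2)) (v := ![i]) h' (eq_iff.2 h)
    exact eq_iff.1 this

theorem mem_congr {i i' j j' : ℕ} (hi : GenericTruth p (eq 0 1 : Fm 2) ![i, i'])
    (hj : GenericTruth p (eq 0 1 : Fm 2) ![j, j']) (h : GenericTruth p (mem 0 1 : Fm 2) ![i, j]) :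
    GenericTruth p (mem 0 1 : Fm 2) ![i', j'] := by
  have h1 : GenericTruth p (mem 0 1 : Fm 2) ![i, j'] :=
    mem_iff.1 (subst (φ := (mem 0 1 : Fm 2)) (v := ![i]) hj (mem_iff.2 h))
  exact mem_iff.1 (subst (φ := (mem 1 0 : Fm 2)) (v := ![j']) hi (mem_iff.2 h1))

/-- The model whose elements are the variables, up to generically true equality. -/
def Model (p : Condition) : Type := Quotient (setoid p)

/-- The element given by a variable. -/
def Model.mk (p : Condition) (i : ℕ) : Model p := Quotient.mk (setoid p) i

instance : setLang.Structure (Model p) where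
  funMap f := (f : Empty).elim
  RelMap {n} R := match n, R with
    | _, .mem => fun xs => Quotient.liftOn₂ (xs 0) (xs 1)
      (fun i j => GenericTruth p (mem 0 1 : Fm 2) ![i, j]) fun _ _ _ _ h h' =>
        propext ⟨mem_congr h h', mem_congr ((setoid p).symm h) ((setoid p).symm h')⟩

/-- The truth lemma. Every element of the model is named by a variable, so quantifiers over the
model reduce to `all_iff`. -/
theorem realize_iff (φ : Fm m) (v : Fin m → ℕ) :
    φ.Realize default (fun i => Model.mk p (v i)) ↔ GenericTruth p φ v := by
  induction φ using Fm.induction with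
  | falsum => exact iff_of_false (fun h => h) not_bot
  | eq x y =>
    rw [eq_iff]
    exact Quotient.eq (r := setoid p)
  | mem x y =>
    rw [mem_iff]
    exact Iff.rfl
  | imp φ ψ h1 h2 => rw [imp_iff, Language.BoundedFormula.realize_imp, h1, h2]
  | all φ h =>
    rw [all_iff, Language.BoundedFormula.realize_all]
    have key : ∀ i : ℕ, φ.Realize default (Fin.snoc (α := fun _ => Model p)
        (fun j => Model.mk p (v j)) (Model.mk p i)) ↔
          GenericTruth p φ (Fin.snoc (α := fun _ => ℕ) v i) := fun i => by
      rw [← h]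
      refine iff_of_eq (congrArg _ (funext fun j => ?_))
      refine Fin.lastCases ?_ (fun j => ?_) j <;> simp
    exact ⟨fun H i => (key i).1 (H _), fun H x => Quotient.inductionOn x fun i => (key i).2 (H i)⟩

end GenericTruth

/-! ### Membership in a structure, and Gödel's completeness theorem. -/

/-- The membership relation of a structure for the language of set theory. -/
def E {M : Type} [setLang.Structure M] (x y : M) : Prop :=
  Language.Structure.RelMap (L := setLang) SetRel.mem ![x, y]

infix:50 " ∈' " => E

theorem realize_mem {M : Type} [setLang.Structure M] {x y : Fin n} {v : Empty → M}
    {xs : Fin n → M} : (mem x y).Realize v xs ↔ xs x ∈' xs y := by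
  refine iff_of_eq (congrArg (Language.Structure.RelMap (L := setLang) SetRel.mem) ?_)
  funext i
  fin_cases i <;> rfl

theorem realize_eq {M : Type} [setLang.Structure M] {x y : Fin n} {v : Empty → M} {xs : Fin n → M} :
    (eq x y).Realize v xs ↔ xs x = xs y := Iff.rfl

theorem realize_rename {M : Type} [setLang.Structure M] (φ : Fm m) : ∀ {n : ℕ} (f : Fin m → Fin n)
    (xs : Fin n → M), (rename φ f).Realize default xs ↔ φ.Realize default (fun i => xs (f i)) := by
  induction φ using Fm.induction with
  | falsum => intros; rfl
  | eq x y => intros; rfl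
  | mem x y =>
    intro n f xs
    rw [rename_mem, realize_mem, realize_mem]
  | imp φ ψ h1 h2 =>
    intros
    simp only [rename_imp, Language.BoundedFormula.realize_imp, h1, h2]
  | all φ h =>
    intro n f xs
    simp only [rename_all, Language.BoundedFormula.realize_all, h]
    refine forall_congr' fun x => iff_of_eq (congrArg _ (funext fun j => ?_))
    refine Fin.lastCases ?_ (fun j => ?_) j <;> simp [push_last, push_castSucc]

/-- Gödel's completeness theorem, for theories that contain an existential sentence. -/
theorem Proves.of_models {T : setLang.Theory} {θ : Fm 1} (hθ : (θ.ex : Fm 0) ∈ T)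
    {σ : setLang.Sentence} (h : ∀ (M : Type) [setLang.Structure M], M ⊨ T → M ⊨ σ) :
    Proves T σ := by
  by_contra hσ
  -- Conditions have at least one variable. A contradiction involving one fresh variable would prove
  -- `∀ x, ∼θ`, against `∃ x, θ` in `T`.
  have hc : Consistent ((fun γ => rename γ Fin.castSucc) '' (insert (∼σ) T)) := by
    intro hc
    refine hσ (.byContra (.impElim (φ := (∼θ).all) (.assumption (.inr hθ)) (.allIntro ?_)))
    exact .impIntro (hc.weaken (Set.subset_insert _ _))
  let p : Condition := ⟨0, _, hc⟩
  have key : ∀ τ ∈ insert (∼σ) T, GenericTruth.Model p ⊨ τ := fun τ hτ => by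
    have h1 := GenericTruth.of_forms (p := p) (Set.mem_image_of_mem _ hτ)
    rw [← GenericTruth.realize_iff, realize_rename] at h1
    rwa [Subsingleton.elim (fun i : Fin 0 => GenericTruth.Model.mk p i↗) default] at h1
  exact key _ (.inl rfl) (h _ ⟨fun τ hτ => key τ (.inr hτ)⟩)


/-! ### Definable predicates and functions -/

section Definability

variable {M : Type} [setLang.Structure M]

/-- The predicate `P` is first-order definable with parameters. -/
class Df (P : (Fin n → M) → Prop) : Prop where
  out : ∃ (k : ℕ) (p : Fin k → M) (φ : Fm (k + n)),
    ∀ x, φ.Realize default (Fin.append p x) ↔ P x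

theorem Df.congr {P Q : (Fin n → M) → Prop} (h : Df P) (hPQ : ∀ x, P x ↔ Q x) : Df Q := by
  obtain ⟨k, p, φ, hφ⟩ := h
  exact ⟨k, p, φ, fun x => (hφ x).trans (hPQ x)⟩

/-- The proposition `c` belongs to the metatheory; it is decided there and replaced by a true or a
false sentence. -/
instance Df.const (c : Prop) : Df (fun _ : Fin n → M => c) := by
  by_cases h : c
  · exact ⟨0, Fin.elim0, ∼⊥, fun x => iff_of_true (fun h => h) h⟩
  · exact ⟨0, Fin.elim0, ⊥, fun x => iff_of_false (fun h => h) h⟩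

instance Df.imp (P Q : (Fin n → M) → Prop) [hP : Df P] [hQ : Df Q] :
    Df (fun x => P x → Q x) := by
  obtain ⟨k, p, φ, hφ⟩ := hP
  obtain ⟨l, q, ψ, hψ⟩ := hQ
  refine ⟨k + l, Fin.append p q,
    rename φ (Fin.append (fun i => (i.castAdd l).castAdd n) (fun i => i.natAdd (k + l))) ⟹
    rename ψ (Fin.append (fun i => (i.natAdd k).castAdd n) (fun i => i.natAdd (k + l))),
    fun x => ?_⟩
  rw [Language.BoundedFormula.realize_imp, realize_rename, realize_rename, ← hφ, ← hψ]
  refine iff_of_eq (congrArg₂ (fun a b => φ.Realize default a → ψ.Realize default b) ?_ ?_) <;>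
  · funext i
    refine Fin.addCases (fun i => ?_) (fun i => ?_) i <;> simp

theorem Df.rename {P : (Fin n → M) → Prop} (hP : Df P) (s : Fin n → Fin m) :
    Df (fun x => P (fun i => x (s i))) := by
  obtain ⟨k, p, φ, hφ⟩ := hP
  refine ⟨k, p, LST.rename φ (Fin.append (fun i => i.castAdd m) (fun i => (s i).natAdd k)),
    fun x => ?_⟩
  rw [realize_rename, ← hφ]
  refine iff_of_eq (congrArg _ ?_)
  funext i
  refine Fin.addCases (fun i => ?_) (fun i => ?_) i <;> simp

instance Df.all (P : (Fin n → M) → M → Prop)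
    [hP : Df (fun x : Fin (n + 1) → M => P (fun i => x i.castSucc) (x (Fin.last n)))] :
    Df (fun x => ∀ y, P x y) := by
  obtain ⟨k, p, φ, hφ⟩ := hP
  refine ⟨k, p, Language.BoundedFormula.all (n := k + n) φ, fun x => ?_⟩
  rw [Language.BoundedFormula.realize_all]
  refine forall_congr' fun y => ?_
  have := hφ (Fin.snoc x y)
  rw [Fin.append_snoc] at this
  simpa using this

instance Df.not (P : (Fin n → M) → Prop) [Df P] : Df (fun x => ¬ P x) :=
  Df.imp P (fun _ => False)

instance Df.or (P Q : (Fin n → M) → Prop) [Df P] [Df Q] : Df (fun x => P x ∨ Q x) :=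
  (Df.imp (fun x => ¬ P x) Q).congr fun x => by tauto

instance Df.and (P Q : (Fin n → M) → Prop) [Df P] [Df Q] : Df (fun x => P x ∧ Q x) :=
  (Df.not fun x => (P x → ¬ Q x)).congr fun x => by tauto

instance Df.iff (P Q : (Fin n → M) → Prop) [Df P] [Df Q] : Df (fun x => P x ↔ Q x) :=
  (Df.and (fun x => P x → Q x) fun x => Q x → P x).congr fun x => by tauto

instance Df.ex (P : (Fin n → M) → M → Prop)
    [Df (fun x : Fin (n + 1) → M => P (fun i => x i.castSucc) (x (Fin.last n)))] :
    Df (fun x => ∃ y, P x y) :=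
  (Df.not fun x => ∀ y, ¬ P x y).congr fun x => by simp

/-- The function `f` is first-order definable with parameters. -/
class DfF (f : (Fin n → M) → M) : Prop where
  out : Df (fun x : Fin (n + 1) → M => f (fun i => x i.castSucc) = x (Fin.last n))

/-- Functions with definable graph are definable. -/
theorem DfF.of_graph {f : (Fin n → M) → M} (P : (Fin n → M) → M → Prop)
    (h : ∀ x y, f x = y ↔ P x y)
    [hP : Df (fun x : Fin (n + 1) → M => P (fun i => x i.castSucc) (x (Fin.last n)))] : DfF f :=
  ⟨hP.congr fun _ => (h _ _).symm⟩

theorem Df.coord_eq (i j : Fin n) : Df (fun x : Fin n → M => x i = x j) :=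
  ⟨0, Fin.elim0, eq (i.natAdd 0) (j.natAdd 0), fun x => by simp [realize_eq]⟩

theorem Df.coord_mem (i j : Fin n) : Df (fun x : Fin n → M => x i ∈' x j) :=
  ⟨0, Fin.elim0, mem (i.natAdd 0) (j.natAdd 0), fun x => by simp [realize_mem]⟩

instance DfF.coord (i : Fin n) : DfF (fun x : Fin n → M => x i) := ⟨Df.coord_eq _ _⟩

instance DfF.const (c : M) : DfF (fun _ : Fin n → M => c) :=
  ⟨⟨1, ![c], eq ((0 : Fin 1).castAdd (n + 1)) ((Fin.last n).natAdd 1), fun x => by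
    rw [realize_eq, Fin.append_left, Fin.append_right]
    rfl⟩⟩

/-- Substitution of a definable function into a definable predicate. -/
theorem Df.subst {P : (Fin (n + 1) → M) → Prop} (hP : Df P) {f : (Fin n → M) → M} [hf : DfF f] :
    Df (fun x => P (Fin.snoc (α := fun _ => M) x (f x))) := by
  have h1 : Df (fun x : Fin (n + 1) → M => f (fun i => x i.castSucc) = x (Fin.last n) ∧ P x) :=
    @Df.and _ _ _ _ _ hf.out hP
  have := @Df.ex _ _ _ (fun (x : Fin n → M) y => f x = y ∧ P (Fin.snoc (α := fun _ => M) x y))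
    (h1.congr fun x => by
      have : (Fin.snoc (α := fun _ => M) (fun i => x i.castSucc) (x (Fin.last n))) = x :=
        Fin.snoc_init_self x
      rw [this])
  exact this.congr fun x => by simp

/-- Simultaneous substitution of definable functions into a definable predicate. -/
theorem Df.comp {P : (Fin k → M) → Prop} (hP : Df P) (f : Fin k → (Fin n → M) → M)
    (hf : ∀ i, DfF (f i)) : Df (fun x => P (fun i => f i x)) := by
  -- Keeping the `n` original variables in front allows the functions to be substituted one at a
  -- time, the last one first, by `Df.subst`.
  suffices ∀ (k : ℕ) (P : (Fin (n + k) → M) → Prop) (_ : Df P) (f : Fin k → (Fin n → M) → M)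
      (_ : ∀ i, DfF (f i)), Df (fun x => P (Fin.append x (fun i => f i x))) by
    refine (this k _ (hP.rename (fun i => i.natAdd n)) f hf).congr fun x => ?_
    simp
  clear comp hP hf f P k
  intro k
  induction k with
  | zero =>
    intro P hP f _
    refine (hP.rename (fun i => i)).congr fun x => iff_of_eq (congrArg P ?_)
    funext i
    exact (Fin.append_left x (fun i => f i x) i).symm
  | succ k ih =>
    intro P hP f hf
    have hlast : DfF (fun x : Fin (n + k) → M => f (Fin.last k) (fun i => x (i.castAdd k))) := by
      refine ⟨((hf (Fin.last k)).out.rename (Fin.snoc (α := fun _ => Fin (n + k + 1))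
        (fun i => (i.castAdd k).castSucc) (Fin.last _))).congr fun x => ?_⟩
      simp
    have := ih _ (Df.subst (n := n + k) (P := P) hP (hf := hlast)) (fun i => f i.castSucc)
      (fun i => hf _)
    refine this.congr fun x => iff_of_eq (congrArg P ?_)
    simp only [Fin.append_left]
    rw [← Fin.append_snoc]
    congr 1
    exact Fin.snoc_init_self (fun i => f i x)

theorem DfF.comp {g : (Fin k → M) → M} (hg : DfF g) (f : Fin k → (Fin n → M) → M)
    (hf : ∀ i, DfF (f i)) : DfF (fun x => g (fun i => f i x)) := by
  refine ⟨(Df.comp hg.out (Fin.snoc (α := fun _ => (Fin (n + 1) → M) → M)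
    (fun i x => f i (fun j => x j.castSucc)) (fun x => x (Fin.last n))) fun i => ?_).congr
    fun x => ?_⟩
  · refine Fin.lastCases ?_ (fun i => ?_) i
    · simp only [Fin.snoc_last]
      infer_instance
    · simp only [Fin.snoc_castSucc]
      refine ⟨((hf i).out.rename (Fin.snoc (α := fun _ => Fin (n + 1 + 1))
        (fun i => i.castSucc.castSucc) (Fin.last _))).congr fun x => ?_⟩
      simp
  · simp

/-- Definable unary predicates. -/
abbrev Df₁ (P : M → Prop) : Prop := Df (fun x : Fin 1 → M => P (x 0))

/-- Definable binary predicates. -/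
abbrev Df₂ (P : M → M → Prop) : Prop := Df (fun x : Fin 2 → M => P (x 0) (x 1))

/-- Definable unary functions. -/
abbrev DfF₁ (f : M → M) : Prop := DfF (fun x : Fin 1 → M => f (x 0))

/-- Definable binary functions. -/
abbrev DfF₂ (f : M → M → M) : Prop := DfF (fun x : Fin 2 → M => f (x 0) (x 1))

section Composition

variable {f g : (Fin n → M) → M}

theorem Df₁.comp {P : M → Prop} (hP : Df₁ P) (hf : DfF f) : Df (fun x => P (f x)) :=
  Df.comp hP (fun _ => f) fun _ => hf

theorem Df₂.comp {P : M → M → Prop} (hP : Df₂ P) (hf : DfF f) (hg : DfF g) :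
    Df (fun x => P (f x) (g x)) :=
  Df.comp hP ![f, g] fun i => by fin_cases i <;> assumption

theorem DfF₁.comp {h : M → M} (hh : DfF₁ h) (hf : DfF f) : DfF (fun x => h (f x)) :=
  DfF.comp hh (fun _ => f) fun _ => hf

theorem DfF₂.comp {h : M → M → M} (hh : DfF₂ h) (hf : DfF f) (hg : DfF g) :
    DfF (fun x => h (f x) (g x)) :=
  DfF.comp hh ![f, g] fun i => by fin_cases i <;> assumption

/-- Together with the connectives and quantifiers, the instances for atomic formulas let instance
search establish definability of compound predicates. -/
instance Df.mem [hf : DfF f] [hg : DfF g] : Df (fun x => f x ∈' g x) :=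
  Df₂.comp (P := fun a b => a ∈' b) (Df.coord_mem 0 1) hf hg

instance Df.eq [hf : DfF f] [hg : DfF g] : Df (fun x => f x = g x) :=
  Df₂.comp (P := fun a b => a = b) (Df.coord_eq 0 1) hf hg

end Composition

instance Df.realize (φ : Fm k) : Df (fun x : Fin k → M => φ.Realize default x) :=
  ⟨0, Fin.elim0, LST.rename φ (fun i => i.natAdd 0), fun x => by
    rw [realize_rename]
    simp⟩

open Classical in
instance DfF.ite (P : (Fin n → M) → Prop) (f g : (Fin n → M) → M) [hP : Df P] [hf : DfF f]
    [hg : DfF g] : DfF (fun x => if P x then f x else g x) := by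
  have h1 : Df (fun x : Fin (n + 1) → M => P (fun i => x i.castSucc)) := hP.rename _
  have h2 := hf.out
  have h3 := hg.out
  refine ⟨(Df.or (fun x : Fin (n + 1) → M => P (fun i => x i.castSucc) ∧
    f (fun i => x i.castSucc) = x (Fin.last n)) (fun x => ¬ P (fun i => x i.castSucc) ∧
    g (fun i => x i.castSucc) = x (Fin.last n))).congr fun x => ?_⟩
  split_ifs <;> simp [*]

end Definability


/-! ### The meaning of the basic formulas -/

theorem snoc_push {M : Type} {xs : Fin n → M} (f : Fin m → Fin n) (x : Fin n) :
    (fun i => xs (push f x i)) = Fin.snoc (α := fun _ => M) (fun i => xs (f i)) (xs x) := by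
  funext i
  refine Fin.lastCases ?_ (fun i => ?_) i <;> simp [push_last, push_castSucc]

theorem snoc_eq_append {M : Type} (p : Fin k → M) (x : M) :
    Fin.snoc (α := fun _ => M) p x = Fin.append p (fun _ : Fin 1 => x) :=
  (Fin.append_right_eq_snoc p (fun _ => x)).symm

section Realize

variable {M : Type} [setLang.Structure M] {v : Empty → M} {xs : Fin n → M}

theorem realize_allF {f : Fin (n + 1) → Fm (n + 1)} :
    (allF f).Realize v xs ↔
      ∀ a, (f (Fin.last n)).Realize v (Fin.snoc (α := fun _ => M) xs a) :=
  Language.BoundedFormula.realize_all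

theorem realize_exF {f : Fin (n + 1) → Fm (n + 1)} :
    (exF f).Realize v xs ↔
      ∃ a, (f (Fin.last n)).Realize v (Fin.snoc (α := fun _ => M) xs a) :=
  Language.BoundedFormula.realize_ex

theorem realize_ballF {x : Fin n} {f : Fin (n + 1) → Fm (n + 1)} :
    (ballF x f).Realize v xs ↔
      ∀ a, a ∈' xs x → (f (Fin.last n)).Realize v (Fin.snoc (α := fun _ => M) xs a) := by
  simp only [ballF, realize_allF, Language.BoundedFormula.realize_imp, realize_mem, Fin.snoc_last,
    Fin.snoc_castSucc]

theorem realize_bexF {x : Fin n} {f : Fin (n + 1) → Fm (n + 1)} :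
    (bexF x f).Realize v xs ↔
      ∃ a, a ∈' xs x ∧ (f (Fin.last n)).Realize v (Fin.snoc (α := fun _ => M) xs a) := by
  simp only [bexF, realize_exF, Language.BoundedFormula.realize_inf, realize_mem, Fin.snoc_last,
    Fin.snoc_castSucc]

theorem realize_rename' {φ : Fm m} {f : Fin m → Fin n} :
    (rename φ f).Realize v xs ↔ φ.Realize default (fun i => xs (f i)) := by
  rw [Subsingleton.elim v default, realize_rename]

/-- `z` is the set `{x, y}`. -/
def IsPair (z x y : M) : Prop := ∀ u, u ∈' z ↔ (u = x ∨ u = y)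

/-- `p` is the ordered pair `(x, y)`. -/
def IsOPair (p x y : M) : Prop := ∀ z, z ∈' p ↔ (IsPair z x x ∨ IsPair z x y)

/-- `x ⊆ y` -/
def Subset (x y : M) : Prop := ∀ z, z ∈' x → z ∈' y

infix:50 " ⊆' " => Subset

theorem realize_isPair {z x y : Fin n} :
    (isPair z x y).Realize v xs ↔ IsPair (xs z) (xs x) (xs y) := by
  simp only [isPair, IsPair, realize_allF, Language.BoundedFormula.realize_iff,
    Language.BoundedFormula.realize_sup, realize_mem, realize_eq, Fin.snoc_last, Fin.snoc_castSucc]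

theorem realize_isOPair {p x y : Fin n} :
    (isOPair p x y).Realize v xs ↔ IsOPair (xs p) (xs x) (xs y) := by
  simp only [isOPair, IsOPair, realize_allF, Language.BoundedFormula.realize_iff, realize_isPair,
    Language.BoundedFormula.realize_sup, realize_mem, Fin.snoc_last, Fin.snoc_castSucc]

theorem realize_subset {x y : Fin n} : (subset x y).Realize v xs ↔ xs x ⊆' xs y := by
  simp only [subset, Subset, realize_ballF, realize_mem, Fin.snoc_last, Fin.snoc_castSucc]

theorem realize_pairMem {f x y : Fin n} :
    (pairMem f x y).Realize v xs ↔ ∃ p, p ∈' xs f ∧ IsOPair p (xs x) (xs y) := by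
  simp only [pairMem, realize_bexF, realize_isOPair, Fin.snoc_last, Fin.snoc_castSucc]

end Realize

/-! ### The axioms of ZFC in a model -/

/-- A slice of a definable relation is definable. -/
theorem Df.slice {M : Type} [setLang.Structure M] (P : (Fin n → M) → M → Prop)
    (hP : Df (fun x : Fin (n + 1) → M => P (fun i => x i.castSucc) (x (Fin.last n))))
    (x : Fin n → M) : Df₁ (P x) := by
  refine (Df.comp hP (Fin.snoc (α := fun _ => (Fin 1 → M) → M) (fun i _ => x i) (fun y => y 0))
    fun i => ?_).congr fun y => ?_
  · refine Fin.lastCases ?_ (fun i => ?_) i <;> simp <;> infer_instance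
  · simp

theorem DfF.slice {M : Type} [setLang.Structure M] (f : (Fin n → M) → M → M)
    (hf : DfF (fun x : Fin (n + 1) → M => f (fun i => x i.castSucc) (x (Fin.last n))))
    (x : Fin n → M) : DfF₁ (f x) := by
  refine ⟨(Df.comp hf.out (Fin.snoc (α := fun _ => (Fin 2 → M) → M)
    (Fin.snoc (α := fun _ => (Fin 2 → M) → M) (fun i _ => x i) (fun y => y 0)) (fun y => y 1))
    fun i => ?_).congr fun y => ?_⟩
  · refine Fin.lastCases ?_ (fun i => ?_) i
    · simp; infer_instance
    · refine Fin.lastCases ?_ (fun i => ?_) i <;> simp <;> infer_instance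
  · simp

section Axioms

variable {M : Type} [setLang.Structure M] [hM : M ⊨ ZFC]

theorem realize_axiom {σ : setLang.Sentence} (h : σ ∈ ZFC) :
    Language.BoundedFormula.Realize (M := M) σ default default :=
  hM.realize_of_mem σ h

theorem ext {x y : M} (h : ∀ z, z ∈' x ↔ z ∈' y) : x = y := by
  have := realize_axiom (M := M) (σ := extensionality) (by simp [ZFC])
  simp only [extensionality, realize_allF, Language.BoundedFormula.realize_iff,
    Language.BoundedFormula.realize_imp, realize_mem, realize_eq, Fin.snoc_last,
    Fin.snoc_castSucc] at this
  exact this x y h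

theorem exists_minimal {x : M} (h : ∃ y, y ∈' x) : ∃ y, y ∈' x ∧ ∀ z, z ∈' x → ¬ z ∈' y := by
  have := realize_axiom (M := M) (σ := foundation) (by simp [ZFC])
  simp only [foundation, realize_allF, realize_exF, realize_bexF, realize_ballF,
    Language.BoundedFormula.realize_not, Language.BoundedFormula.realize_imp, realize_mem,
    Fin.snoc_last, Fin.snoc_castSucc] at this
  exact this x h

theorem exists_pair (x y : M) : ∃ z : M, ∀ u, u ∈' z ↔ (u = x ∨ u = y) := by
  have := realize_axiom (M := M) (σ := pairing) (by simp [ZFC])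
  simp only [pairing, realize_allF, realize_exF, realize_isPair, Fin.snoc_last,
    Fin.snoc_castSucc] at this
  exact this x y

theorem exists_sUnion (x : M) : ∃ z : M, ∀ u, u ∈' z ↔ ∃ y, y ∈' x ∧ u ∈' y := by
  have := realize_axiom (M := M) (σ := union) (by simp [ZFC])
  simp only [union, realize_allF, realize_exF, realize_bexF, realize_mem, Fin.snoc_last,
    Fin.snoc_castSucc, Language.BoundedFormula.realize_iff] at this
  exact this x

theorem exists_powerset (x : M) : ∃ z : M, ∀ u, u ∈' z ↔ u ⊆' x := by
  have := realize_axiom (M := M) (σ := powerSet) (by simp [ZFC])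
  simp only [powerSet, realize_allF, realize_exF, realize_subset, realize_mem, Fin.snoc_last,
    Fin.snoc_castSucc, Language.BoundedFormula.realize_iff] at this
  exact this x

theorem exists_transversal (F : M) (h1 : ∀ x, x ∈' F → ∃ y, y ∈' x)
    (h2 : ∀ x, x ∈' F → ∀ y, y ∈' F → (∃ z, z ∈' x ∧ z ∈' y) → x = y) :
    ∃ c : M, ∀ x, x ∈' F → ∃ z, ∀ u, (u ∈' x ∧ u ∈' c) ↔ u = z := by
  have := realize_axiom (M := M) (σ := choice) (by simp [ZFC])
  simp only [choice, realize_allF, realize_exF, realize_ballF, realize_mem, realize_eq,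
    Fin.snoc_last, Fin.snoc_castSucc, Language.BoundedFormula.realize_iff,
    Language.BoundedFormula.realize_imp, Language.BoundedFormula.realize_inf] at this
  exact this F ⟨h1, h2⟩

/-- The parameters that witness definability of `P` become the parameters of an instance of
separation. -/
theorem exists_sep (a : M) (P : M → Prop) [hP : Df₁ P] : ∃ b : M, ∀ x, x ∈' b ↔ x ∈' a ∧ P x := by
  obtain ⟨k, p, φ, hφ⟩ := hP
  have := realize_axiom (M := M) (σ := separation φ) (.inl (.inr ⟨_, φ, rfl⟩))
  simp only [separation] at this
  have := (Language.BoundedFormula.realize_alls (v := (default : Empty → M))).1 this p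
  simp only [realize_allF, realize_exF, realize_mem, Fin.snoc_last, realize_rename', snoc_push,
    Fin.snoc_castSucc, Language.BoundedFormula.realize_iff,
    Language.BoundedFormula.realize_inf] at this
  obtain ⟨b, hb⟩ := this a
  refine ⟨b, fun x => (hb x).trans (and_congr_right' ?_)⟩
  rw [snoc_eq_append]
  exact hφ _

theorem exists_image (a : M) (F : M → M) [hF : DfF₁ F] :
    ∃ b : M, ∀ y, y ∈' b ↔ ∃ x, x ∈' a ∧ F x = y := by
  obtain ⟨k, p, φ, hφ⟩ := hF.out
  have := realize_axiom (M := M) (σ := replacement φ) (.inr ⟨_, φ, rfl⟩)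
  simp only [replacement] at this
  have := (Language.BoundedFormula.realize_alls (v := (default : Empty → M))).1 this p
  have key : ∀ x y : M, φ.Realize default (Fin.snoc (α := fun _ => M)
      (Fin.snoc (α := fun _ => M) p x) y) ↔ F x = y := fun x y => by
    have := hφ (Fin.snoc (α := fun _ => M) (fun _ : Fin 1 => x) y)
    rw [Fin.append_snoc, ← snoc_eq_append] at this
    simpa only [Fin.snoc_last, Fin.snoc_castSucc] using this
  simp only [realize_allF, realize_exF, realize_bexF, realize_mem, Fin.snoc_last, realize_rename',
    snoc_push, Fin.snoc_castSucc, Language.BoundedFormula.realize_iff, realize_eq, key,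
    Language.BoundedFormula.realize_imp, Language.BoundedFormula.realize_inf] at this
  exact this (fun x y z ⟨h1, h2⟩ => h1.symm.trans h2) a


/-! ### Set operations in a model -/

variable (M) in
/-- A model of set theory has an element. -/
theorem nonempty_model : Nonempty M := by
  have := realize_axiom (M := M) (σ := infinity) (by simp [ZFC])
  simp only [infinity, realize_exF] at this
  exact ⟨this.choose⟩

open Classical in
/-- The set with elements given by `P`, if there is one. -/
noncomputable def setOf' (P : M → Prop) : M :=
  if h : ∃ b : M, ∀ x, x ∈' b ↔ P x then h.choose else (nonempty_model M).some

theorem mem_setOf' {P : M → Prop} (h : ∃ b : M, ∀ x, x ∈' b ↔ P x) {x : M} :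
    x ∈' setOf' P ↔ P x := by
  rw [setOf', dif_pos h]
  exact h.choose_spec x

theorem setOf'_eq_iff {P : M → Prop} (h : ∃ b : M, ∀ x, x ∈' b ↔ P x) {y : M} :
    setOf' P = y ↔ ∀ x, x ∈' y ↔ P x :=
  ⟨fun hy _ => hy ▸ mem_setOf' h, fun hy => ext fun z => (mem_setOf' h).trans (hy z).symm⟩

/-- By extensionality the graph is given by `∀ z, z ∈' y ↔ P x z`, which is definable. -/
theorem DfF.setOf' (P : (Fin n → M) → M → Prop) (h : ∀ x, ∃ b : M, ∀ y, y ∈' b ↔ P x y)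
    [hP : Df (fun x : Fin (n + 1) → M => P (fun i => x i.castSucc) (x (Fin.last n)))] :
    DfF (fun x => setOf' (P x)) := by
  have : Df (fun x : Fin (n + 1 + 1) → M =>
      P (fun i => x i.castSucc.castSucc) (x (Fin.last _))) := by
    refine (hP.rename (Fin.snoc (α := fun _ => Fin (n + 2)) (fun i => i.castSucc.castSucc)
      (Fin.last _))).congr fun x => ?_
    simp
  exact .of_graph (fun x y => ∀ z, z ∈' y ↔ P x z) (fun x y => setOf'_eq_iff (h x))

/-- `{x ∈ a | P x}` -/
noncomputable def sep (a : M) (P : M → Prop) : M := setOf' fun x => x ∈' a ∧ P x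

@[simp]
theorem mem_sep {a x : M} {P : M → Prop} [Df₁ P] : x ∈' sep a P ↔ x ∈' a ∧ P x :=
  mem_setOf' (exists_sep a P)

instance DfF.sep (a : (Fin n → M) → M) (P : (Fin n → M) → M → Prop) [ha : DfF a]
    [hP : Df (fun x : Fin (n + 1) → M => P (fun i => x i.castSucc) (x (Fin.last n)))] :
    DfF (fun x => sep (a x) (P x)) := by
  have ha' : DfF (fun x : Fin (n + 1) → M => a fun i => x i.castSucc) :=
    ha.comp _ fun i => inferInstance
  exact DfF.setOf' _ fun x => @exists_sep _ _ _ _ _ (hP.slice _ x)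

/-- `{F x | x ∈ a}` -/
noncomputable def image (a : M) (F : M → M) : M := setOf' fun y => ∃ x, x ∈' a ∧ F x = y

@[simp]
theorem mem_image {a y : M} {F : M → M} [DfF₁ F] : y ∈' image a F ↔ ∃ x, x ∈' a ∧ F x = y :=
  mem_setOf' (exists_image a F)

instance DfF.image (a : (Fin n → M) → M) (F : (Fin n → M) → M → M) [ha : DfF a]
    [hF : DfF (fun x : Fin (n + 1) → M => F (fun i => x i.castSucc) (x (Fin.last n)))] :
    DfF (fun x => image (a x) (F x)) := by
  have ha' : DfF (fun x : Fin (n + 1 + 1) → M => a fun i => x i.castSucc.castSucc) :=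
    ha.comp _ fun i => inferInstance
  have hF' : DfF (fun x : Fin (n + 1 + 1) → M => F (fun i => x i.castSucc.castSucc)
      (x (Fin.last (n + 1)))) := by
    have := hF.comp (Fin.snoc (α := fun _ => (Fin (n + 1 + 1) → M) → M)
      (fun i x => x i.castSucc.castSucc) (fun x => x (Fin.last (n + 1)))) fun i => by
        refine Fin.lastCases ?_ (fun i => ?_) i <;> simp <;> infer_instance
    simpa using this
  exact DfF.setOf' _ fun x => @exists_image _ _ _ _ _ (hF.slice _ x)

/-- `{x, y}` -/
noncomputable def upair (x y : M) : M := setOf' fun u => u = x ∨ u = y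

@[simp]
theorem mem_upair {x y u : M} : u ∈' upair x y ↔ u = x ∨ u = y := mem_setOf' (exists_pair x y)

instance (f g : (Fin n → M) → M) [hf : DfF f] [hg : DfF g] : DfF (fun x => upair (f x) (g x)) :=
  DfF₂.comp (h := upair) (DfF.setOf' (fun x u => u = x 0 ∨ u = x 1) fun _ => exists_pair _ _) hf hg

/-- `⋃ x` -/
noncomputable def sUnion (x : M) : M := setOf' fun u => ∃ y, y ∈' x ∧ u ∈' y

@[simp]
theorem mem_sUnion {x u : M} : u ∈' sUnion x ↔ ∃ y, y ∈' x ∧ u ∈' y := mem_setOf' (exists_sUnion x)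

instance (f : (Fin n → M) → M) [hf : DfF f] : DfF (fun x => sUnion (f x)) :=
  DfF₁.comp (h := sUnion) (DfF.setOf' (fun x u => ∃ y, y ∈' x 0 ∧ u ∈' y)
    fun _ => exists_sUnion _) hf

/-- The power set of `x`. -/
noncomputable def powerset (x : M) : M := setOf' fun u => u ⊆' x

@[simp]
theorem mem_powerset {x u : M} : u ∈' powerset x ↔ u ⊆' x := mem_setOf' (exists_powerset x)

/-- `x ∪ y` -/
noncomputable def union' (x y : M) : M := sUnion (upair x y)

@[simp]
theorem mem_union' {x y u : M} : u ∈' union' x y ↔ u ∈' x ∨ u ∈' y := by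
  simp only [union', mem_sUnion, mem_upair, or_and_right, exists_or, exists_eq_left]

instance (f g : (Fin n → M) → M) [hf : DfF f] [hg : DfF g] : DfF (fun x => union' (f x) (g x)) :=
  inferInstanceAs (DfF (fun x => sUnion (upair (f x) (g x))))

variable (M) in
/-- The empty set. -/
noncomputable def empty : M := sep (nonempty_model M).some fun _ => False

@[simp]
theorem not_mem_empty {x : M} : ¬ x ∈' empty M := by simp [empty]

theorem eq_empty_iff {x : M} : x = empty M ↔ ∀ y, ¬ y ∈' x :=
  ⟨fun h _ => h ▸ not_mem_empty, fun h => ext fun y => iff_of_false (h y) not_mem_empty⟩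

/-- The ordered pair `(x, y)`. -/
noncomputable def opair (x y : M) : M := upair (upair x x) (upair x y)

instance (f g : (Fin n → M) → M) [hf : DfF f] [hg : DfF g] : DfF (fun x => opair (f x) (g x)) :=
  inferInstanceAs (DfF (fun x => upair (upair (f x) (f x)) (upair (f x) (g x))))

theorem isPair_iff {z x y : M} : IsPair z x y ↔ z = upair x y :=
  ⟨fun h => ext fun u => (h u).trans mem_upair.symm, fun h _ => h ▸ mem_upair⟩

theorem isOPair_iff {p x y : M} : IsOPair p x y ↔ p = opair x y := by
  simp only [IsOPair, isPair_iff]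
  exact ⟨fun h => ext fun u => (h u).trans mem_upair.symm, fun h _ => h ▸ mem_upair⟩

theorem upair_eq_upair {x y z : M} : upair x y = upair x z ↔ y = z := by
  refine ⟨fun h => ?_, fun h => h ▸ rfl⟩
  have h1 : y = x ∨ y = z := mem_upair.1 (h ▸ mem_upair.2 (.inr rfl))
  have h2 : z = x ∨ z = y := mem_upair.1 (h.symm ▸ mem_upair.2 (.inr rfl))
  rcases h1 with h1 | h1
  · rcases h2 with h2 | h2
    · exact h1.trans h2.symm
    · exact h2.symm
  · exact h1

@[simp]
theorem opair_inj {x y x' y' : M} : opair x y = opair x' y' ↔ x = x' ∧ y = y' := by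
  refine ⟨fun h => ?_, by rintro ⟨rfl, rfl⟩; rfl⟩
  have hx : x = x' := by
    have h1 : upair x x ∈' opair x' y' := h ▸ mem_upair.2 (.inl rfl)
    have h2 : x' ∈' upair x x := by
      rcases mem_upair.1 h1 with h1 | h1 <;> rw [h1] <;> exact mem_upair.2 (.inl rfl)
    simp only [mem_upair, or_self] at h2
    exact h2.symm
  subst hx
  exact ⟨rfl, upair_eq_upair.1 (upair_eq_upair.1 h)⟩

theorem mem_asymm {x y : M} (h : x ∈' y) : ¬ y ∈' x := fun h1 => by
  obtain ⟨z, hz, h'⟩ := exists_minimal (x := upair x y) ⟨x, by simp⟩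
  rcases mem_upair.1 hz with rfl | rfl
  · exact h' y (by simp) h1
  · exact h' x (by simp) h

theorem mem_asymm₃ {x y z : M} (h : x ∈' y) (h1 : y ∈' z) : ¬ z ∈' x := fun h2 => by
  obtain ⟨u, hu, h'⟩ := exists_minimal (x := union' (upair x y) (upair z z)) ⟨x, by simp⟩
  simp only [mem_union', mem_upair, or_self] at hu
  rcases hu with (rfl | rfl) | rfl
  · exact h' z (by simp) h2
  · exact h' x (by simp) h
  · exact h' y (by simp) h1

/-- `x × y` -/
noncomputable def prod (x y : M) : M := sUnion (image x fun a => image y fun b => opair a b)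

@[simp]
theorem mem_prod {x y p : M} : p ∈' prod x y ↔ ∃ a, a ∈' x ∧ ∃ b, b ∈' y ∧ opair a b = p := by
  simp [prod]

instance (f g : (Fin n → M) → M) [hf : DfF f] [hg : DfF g] : DfF (fun x => prod (f x) (g x)) :=
  DfF₂.comp (h := prod) (inferInstanceAs (DfF (fun x : Fin 2 → M =>
    sUnion (image (x 0) fun a => image (x 1) fun b => opair a b)))) hf hg

open Classical in
/-- The object with property `P`, or the empty set. -/
noncomputable def the (P : M → Prop) : M := if h : ∃ y, P y then h.choose else empty M

theorem the_eq {P : M → Prop} (h : ∀ y z, P y → P z → y = z) {y : M} (hy : P y) : the P = y := by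
  rw [the, dif_pos ⟨y, hy⟩]
  exact h _ _ (Exists.choose_spec ⟨y, hy⟩) hy

theorem the_eq_empty {P : M → Prop} (h : ∀ y, ¬ P y) : the P = empty M :=
  dif_neg fun ⟨y, hy⟩ => h y hy

theorem DfF.the (P : (Fin n → M) → M → Prop) (h : ∀ x y z, P x y → P x z → y = z)
    [hP : Df (fun x : Fin (n + 1) → M => P (fun i => x i.castSucc) (x (Fin.last n)))] :
    DfF (fun x => the (P x)) := by
  have : Df (fun x : Fin (n + 1 + 1) → M =>
      P (fun i => x i.castSucc.castSucc) (x (Fin.last _))) := by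
    refine (hP.rename (Fin.snoc (α := fun _ => Fin (n + 2)) (fun i => i.castSucc.castSucc)
      (Fin.last _))).congr fun x => ?_
    simp
  refine .of_graph (fun x y => P x y ∨ ((∀ y, ¬ P x y) ∧ y = empty M)) fun x y => ?_
  by_cases hx : ∃ y, P x y
  · obtain ⟨z, hz⟩ := hx
    rw [the_eq (h x) hz]
    constructor
    · rintro rfl
      exact .inl hz
    · rintro (h1 | h1)
      · exact h x _ _ hz h1
      · exact (h1.1 z hz).elim
  · rw [not_exists] at hx
    rw [the_eq_empty hx]
    exact ⟨fun h => .inr ⟨hx, h.symm⟩, fun h => (h.resolve_left (hx y)).2.symm⟩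

/-- The first component of an ordered pair. -/
noncomputable def fst (p : M) : M := the fun x => ∃ y, p = opair x y

/-- The second component of an ordered pair. -/
noncomputable def snd (p : M) : M := the fun y => ∃ x, p = opair x y

@[simp]
theorem fst_opair (x y : M) : fst (opair x y) = x :=
  the_eq (fun _ _ ⟨_, h⟩ ⟨_, h'⟩ => (opair_inj.1 (h.symm.trans h')).1) ⟨y, rfl⟩

@[simp]
theorem snd_opair (x y : M) : snd (opair x y) = y :=
  the_eq (fun _ _ ⟨_, h⟩ ⟨_, h'⟩ => (opair_inj.1 (h.symm.trans h')).2) ⟨x, rfl⟩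

instance (f : (Fin n → M) → M) [hf : DfF f] : DfF (fun x => fst (f x)) :=
  DfF₁.comp (h := fst) (DfF.the (fun (p : Fin 1 → M) x => ∃ y, p 0 = opair x y)
    fun _ _ _ ⟨_, h⟩ ⟨_, h'⟩ => (opair_inj.1 (h.symm.trans h')).1) hf

instance (f : (Fin n → M) → M) [hf : DfF f] : DfF (fun x => snd (f x)) :=
  DfF₁.comp (h := snd) (DfF.the (fun (p : Fin 1 → M) y => ∃ x, p 0 = opair x y)
    fun _ _ _ ⟨_, h⟩ ⟨_, h'⟩ => (opair_inj.1 (h.symm.trans h')).2) hf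

end Axioms

/-! ### Well-founded recursion, closure under pairs and elements, and choice functions. -/

section Recursion

variable {M : Type} [setLang.Structure M]

/-- A form suited to instance search: after `have := h.inst`, compound predicates that contain `P`
are recognised as definable. -/
theorem Df₁.inst {P : M → Prop} (h : Df₁ P) (n : ℕ) (f : (Fin n → M) → M) [hf : DfF f] :
    Df (fun x => P (f x)) := h.comp hf

theorem Df₂.inst {P : M → M → Prop} (h : Df₂ P) (n : ℕ) (f g : (Fin n → M) → M) [hf : DfF f]
    [hg : DfF g] : Df (fun x => P (f x) (g x)) := h.comp hf hg

theorem DfF₁.inst {F : M → M} (h : DfF₁ F) (n : ℕ) (f : (Fin n → M) → M) [hf : DfF f] :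
    DfF (fun x => F (f x)) := h.comp hf

theorem DfF₂.inst {F : M → M → M} (h : DfF₂ F) (n : ℕ) (f g : (Fin n → M) → M) [hf : DfF f]
    [hg : DfF g] : DfF (fun x => F (f x) (g x)) := h.comp hf hg

/-- The relation `R` is well-founded on the set `D`, in the sense of the model. -/
def WfOn (D : M) (R : M → M → Prop) : Prop :=
  ∀ Y, Y ⊆' D → (∃ y, y ∈' Y) → ∃ u, u ∈' Y ∧ ∀ v, v ∈' Y → ¬ R v u

variable [hM : M ⊨ ZFC]

/-- Separation must form the set of counterexamples, whence the definability of `P`; a minimal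
counterexample contradicts the induction step. -/
theorem WfOn.induction {D : M} {R : M → M → Prop} (h : WfOn D R) (P : M → Prop) [hP : Df₁ P]
    (ih : ∀ u, u ∈' D → (∀ v, v ∈' D → R v u → P v) → P u) (u : M) (hu : u ∈' D) : P u := by
  have := hP.inst
  by_contra hn
  obtain ⟨y, hy, hmin⟩ := h (sep D fun u => ¬ P u) (fun z hz => (mem_sep.1 hz).1)
    ⟨u, mem_sep.2 ⟨hu, hn⟩⟩
  rw [mem_sep] at hy
  exact hy.2 (ih y hy.1 fun v hv hR => by_contra fun hn => hmin v (mem_sep.2 ⟨hv, hn⟩) hR)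

/-- `f` is a function on a subset of `D` that is closed under `R`-predecessors, and satisfies the
recursion given by `G`. -/
def IsApprox (D : M) (R : M → M → Prop) (G : M → M → M) (f : M) : Prop :=
  (∀ p, p ∈' f → ∃ u y, u ∈' D ∧ p = opair u y) ∧
    ∀ u y, opair u y ∈' f → (∀ v, v ∈' D → R v u → ∃ z, opair v z ∈' f) ∧
      G u (sep f fun p => R (fst p) u) = y

/-- Recursion along a well-founded relation on a set. -/
theorem WfOn.exists_recursion {D : M} {R : M → M → Prop} (hwf : WfOn D R) (hR : Df₂ R)
    (G : M → M → M) (hG : DfF₂ G) :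
    ∃ F : M → M, DfF₁ F ∧
      ∀ u, u ∈' D → F u = G u (image (sep D fun v => R v u) fun v => opair v (F v)) := by
  have := hR.inst
  have := hG.inst
  -- Two approximations agree wherever both are defined: by induction, their restrictions to the
  -- predecessors of `u` coincide.
  have hu : ∀ f g, IsApprox D R G f → IsApprox D R G g → ∀ u, u ∈' D → ∀ y z, opair u y ∈' f →
      opair u z ∈' g → y = z := by
    intro f g hf hg
    refine hwf.induction (fun u => ∀ y z, opair u y ∈' f → opair u z ∈' g → y = z) ?_
    intro u hu ih y z hy hz
    rw [← (hf.2 u y hy).2, ← (hg.2 u z hz).2]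
    congr 1
    refine ext fun p => ?_
    simp only [mem_sep]
    refine and_congr_left fun hp => ⟨fun h => ?_, fun h => ?_⟩
    · obtain ⟨v, y', hv, rfl⟩ := hf.1 p h
      rw [fst_opair] at hp
      obtain ⟨z', hz'⟩ := (hg.2 u z hz).1 v hv hp
      rwa [ih v hv hp _ _ h hz']
    · obtain ⟨v, y', hv, rfl⟩ := hg.1 p h
      rw [fst_opair] at hp
      obtain ⟨z', hz'⟩ := (hf.2 u y hy).1 v hv hp
      rwa [← ih v hv hp _ _ hz' h]
  -- The union of all approximations, as a definable relation.
  let Val : M → M → Prop := fun u y => ∃ f, IsApprox D R G f ∧ opair u y ∈' f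
  have hVal : Df₂ Val := by
    unfold Val IsApprox
    infer_instance
  have hVu : ∀ u y z, Val u y → Val u z → y = z := by
    rintro u y z ⟨f, hf, hy⟩ ⟨g, hg, hz⟩
    obtain ⟨v, y', hv, h⟩ := hf.1 _ hy
    obtain ⟨rfl, rfl⟩ := opair_inj.1 h
    exact hu f g hf hg u hv y z hy hz
  have := hVal.inst
  let F : M → M := fun u => the (Val u)
  have hF : DfF₁ F := DfF.the (fun x : Fin 1 → M => Val (x 0)) fun x => hVu (x 0)
  have := hF.inst
  have hFV : ∀ {u y}, Val u y → F u = y := fun {u y} h => the_eq (hVu u) h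
  let S := sep D fun u => ∃ y, Val u y
  let H := image S fun u => opair u (F u)
  have memS : ∀ u, u ∈' S ↔ u ∈' D ∧ ∃ y, Val u y := fun u => mem_sep
  have memH : ∀ p, p ∈' H ↔ ∃ u, u ∈' S ∧ opair u (F u) = p := fun p => mem_image
  have memH' : ∀ u y, opair u y ∈' H ↔ u ∈' D ∧ Val u y := fun u y => by
    rw [memH]
    constructor
    · rintro ⟨v, hv, h⟩
      obtain ⟨rfl, rfl⟩ := opair_inj.1 h
      obtain ⟨hv, z, hz⟩ := (memS _).1 hv
      rw [hFV hz]
      exact ⟨hv, hz⟩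
    · rintro ⟨hu, h⟩
      exact ⟨u, (memS _).2 ⟨hu, y, h⟩, by rw [hFV h]⟩
  have hH : IsApprox D R G H := by
    refine ⟨fun p hp => ?_, fun u y hy => ?_⟩
    · obtain ⟨u, hu, rfl⟩ := (memH p).1 hp
      exact ⟨u, _, ((memS u).1 hu).1, rfl⟩
    · obtain ⟨huD, f, hf, hfy⟩ := (memH' _ _).1 hy
      refine ⟨fun v hv hvu => ?_, ?_⟩
      · obtain ⟨z, hz⟩ := (hf.2 u y hfy).1 v hv hvu
        exact ⟨z, (memH' _ _).2 ⟨hv, f, hf, hz⟩⟩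
      · rw [← (hf.2 u y hfy).2]
        congr 1
        refine ext fun p => ?_
        simp only [mem_sep]
        refine and_congr_left fun hp => ⟨fun h => ?_, fun h => ?_⟩
        · obtain ⟨v, hv, rfl⟩ := (memH p).1 h
          rw [fst_opair] at hp
          obtain ⟨z, hz⟩ := (hf.2 u y hfy).1 v ((memS v).1 hv).1 hp
          rwa [hFV ⟨f, hf, hz⟩]
        · obtain ⟨v, z, hv, rfl⟩ := hf.1 p h
          exact (memH' _ _).2 ⟨hv, f, hf, h⟩
  -- If only `u` itself lacked a value, adding the pair `p₀` to `H` would supply one. The domain `S`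
  -- of `H` is closed under predecessors, so `u` precedes no element of `S` and the recursion
  -- clauses of `H` are undisturbed.
  have htot : ∀ u, u ∈' D → ∃ y, Val u y := by
    refine hwf.induction (fun u => ∃ y, Val u y) ?_
    intro u huD ih
    by_contra hn
    have hnR : ∀ w, w ∈' S → ¬ R u w := fun w hw hR => by
      obtain ⟨z, hz⟩ := (hH.2 w (F w) ((memH _).2 ⟨w, hw, rfl⟩)).1 u huD hR
      exact hn ⟨z, ((memH' _ _).1 hz).2⟩
    have hnu : ¬ R u u := fun h => hn (ih u huD h)
    let p₀ := opair u (G u (sep H fun p => R (fst p) u))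
    have hsep : ∀ w, ¬ R u w → (sep (union' H (upair p₀ p₀)) fun p => R (fst p) w) =
        sep H fun p => R (fst p) w := fun w hw => ext fun p => by
      simp only [mem_sep, mem_union', mem_upair, or_self]
      refine and_congr_left fun hp => or_iff_left ?_
      rintro rfl
      rw [fst_opair] at hp
      exact hw hp
    refine hn ⟨_, union' H (upair p₀ p₀), ⟨fun p hp => ?_, fun w y hw => ?_⟩,
      mem_union'.2 (.inr (mem_upair.2 (.inl rfl)))⟩
    · rcases mem_union'.1 hp with hp | hp
      · exact hH.1 p hp
      · exact ⟨u, _, huD, by simpa using hp⟩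
    · rcases mem_union'.1 hw with hw | hw
      · obtain ⟨h1, h2⟩ := hH.2 w y hw
        refine ⟨fun v hv hR => ?_, ?_⟩
        · obtain ⟨z, hz⟩ := h1 v hv hR
          exact ⟨z, mem_union'.2 (.inl hz)⟩
        · rw [hsep w (hnR w ((memS w).2 ⟨((memH' _ _).1 hw).1, _, ((memH' _ _).1 hw).2⟩)), h2]
      · simp only [mem_upair, or_self, p₀, opair_inj] at hw
        obtain ⟨rfl, rfl⟩ := hw
        refine ⟨fun v hv hR => ?_, by rw [hsep w hnu]⟩
        obtain ⟨z, hz⟩ := ih v hv hR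
        exact ⟨z, mem_union'.2 (.inl ((memH' _ _).2 ⟨hv, hz⟩))⟩
  refine ⟨F, hF, fun u hu => ?_⟩
  obtain ⟨y, hy⟩ := htot u hu
  rw [hFV hy, ← (hH.2 u y ((memH' _ _).2 ⟨hu, hy⟩)).2]
  congr 1
  refine ext fun p => ?_
  simp only [mem_sep, mem_image]
  constructor
  · rintro ⟨hp, hR⟩
    obtain ⟨v, hv, rfl⟩ := (memH p).1 hp
    rw [fst_opair] at hR
    exact ⟨v, ⟨((memS v).1 hv).1, hR⟩, rfl⟩
  · rintro ⟨v, ⟨hv, hR⟩, rfl⟩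
    exact ⟨(memH _).2 ⟨v, (memS v).2 ⟨hv, htot v hv⟩, rfl⟩, by rwa [fst_opair]⟩

theorem wfOn_mem (D : M) : WfOn D (fun v u => v ∈' u) := fun _ _ h => exists_minimal h

/-- A set linearly ordered by membership, without a last element. -/
structure IsLinearLimit (w : M) : Prop where
  nonempty : ∃ i, i ∈' w
  trichotomy : ∀ i j, i ∈' w → j ∈' w → i ∈' j ∨ i = j ∨ j ∈' i
  exists_gt : ∀ i, i ∈' w → ∃ j, j ∈' w ∧ i ∈' j

/-- Every set is contained in a transitive set that is closed under pairs. -/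
theorem IsLinearLimit.exists_closure {w : M} (hw : IsLinearLimit w) (x₀ : M) :
    ∃ W, x₀ ⊆' W ∧ (∀ y z, y ∈' W → z ∈' y → z ∈' W) ∧
      ∀ a b, a ∈' W → b ∈' W → upair a b ∈' W := by
  let C : M → M := fun s => union' s (union' (sUnion s)
    (sUnion (image s fun a => image s fun b => upair a b)))
  have memC : ∀ s z, z ∈' C s ↔ z ∈' s ∨ (∃ y, y ∈' s ∧ z ∈' y) ∨
      ∃ a, a ∈' s ∧ ∃ b, b ∈' s ∧ upair a b = z := fun s z => by simp [C]
  have hC : DfF₁ C := by unfold C; infer_instance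
  have := hC.inst
  -- `F i` is the union of `x₀` and all `C (F j)` with `j ∈ i`, `j ∈ w`. As `w` is linear without
  -- last element, any two elements of the union of the `F i` occur at a common stage, and a later
  -- stage contains their pair.
  obtain ⟨F, hF, hrec⟩ := (wfOn_mem w).exists_recursion (Df.coord_mem 0 1)
    (fun _ f => union' x₀ (sUnion (image f fun p => C (snd p)))) inferInstance
  have := hF.inst
  have memF : ∀ i, i ∈' w → ∀ z, z ∈' F i ↔ z ∈' x₀ ∨ ∃ j, j ∈' w ∧ j ∈' i ∧ z ∈' C (F j) :=
    fun i hi z => by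
      rw [hrec i hi]
      simp [and_assoc]
  have hsucc : ∀ i j z, i ∈' w → j ∈' w → i ∈' j → z ∈' C (F i) → z ∈' F j :=
    fun i j z hi hj hij hz => (memF j hj z).2 (.inr ⟨i, hi, hij, hz⟩)
  have memW : ∀ z, z ∈' sUnion (image w F) ↔ ∃ i, i ∈' w ∧ z ∈' F i := fun z => by simp
  simp only [Subset]
  refine ⟨sUnion (image w F), fun z hz => ?_, fun y z hy hz => ?_, fun a b ha hb => ?_⟩
  · obtain ⟨i, hi⟩ := hw.nonempty
    exact (memW z).2 ⟨i, hi, (memF i hi z).2 (.inl hz)⟩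
  · obtain ⟨i, hi, hy⟩ := (memW y).1 hy
    obtain ⟨j, hj, hij⟩ := hw.exists_gt i hi
    exact (memW z).2 ⟨j, hj, hsucc i j z hi hj hij ((memC _ _).2 (.inr (.inl ⟨y, hy, hz⟩)))⟩
  · obtain ⟨i, hi, ha⟩ := (memW a).1 ha
    obtain ⟨j, hj, hb⟩ := (memW b).1 hb
    have : ∃ l, l ∈' w ∧ a ∈' F l ∧ b ∈' F l := by
      rcases hw.trichotomy i j hi hj with h | rfl | h
      · exact ⟨j, hj, hsucc i j a hi hj h ((memC _ _).2 (.inl ha)), hb⟩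
      · exact ⟨i, hi, ha, hb⟩
      · exact ⟨i, hi, ha, hsucc j i b hj hi h ((memC _ _).2 (.inl hb))⟩
    obtain ⟨l, hl, ha, hb⟩ := this
    obtain ⟨l', hl', h⟩ := hw.exists_gt l hl
    exact (memW _).2 ⟨l', hl', hsucc l l' _ hl hl' h
      ((memC _ _).2 (.inr (.inr ⟨a, ha, b, hb, rfl⟩)))⟩

/-- A definable choice function for the nonempty subsets of `W`. -/
theorem exists_choiceFunction (W : M) :
    ∃ g : M → M, DfF₁ g ∧ ∀ s, s ⊆' W → (∃ z, z ∈' s) → g s ∈' s := by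
  -- The sets `{s} × s` are pairwise disjoint even when the sets `s` are not.
  obtain ⟨c, hc⟩ := exists_transversal
    (image (sep (powerset W) fun s => ∃ z, z ∈' s) fun s => prod (upair s s) s) (fun x hx => by
      simp only [mem_image, mem_sep] at hx
      obtain ⟨s, ⟨-, z, hz⟩, rfl⟩ := hx
      exact ⟨opair s z, by simp [hz]⟩) (fun x hx y hy => by
      simp only [mem_image, mem_sep] at hx hy
      obtain ⟨s, -, rfl⟩ := hx
      obtain ⟨t, -, rfl⟩ := hy
      rintro ⟨p, h1, h2⟩
      simp only [mem_prod, mem_upair, or_self, exists_eq_left] at h1 h2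
      obtain ⟨a, -, rfl⟩ := h1
      obtain ⟨b, -, h⟩ := h2
      rw [(opair_inj.1 h).1])
  have hun : ∀ s y z : M, (∀ z', (z' ∈' s ∧ opair s z' ∈' c) ↔ z' = y) →
      (∀ z', (z' ∈' s ∧ opair s z' ∈' c) ↔ z' = z) → y = z := fun s y z h h' =>
    (h' y).1 ((h y).2 rfl)
  refine ⟨fun s => the fun z => ∀ z', (z' ∈' s ∧ opair s z' ∈' c) ↔ z' = z,
    DfF.the (fun (x : Fin 1 → M) z => ∀ z', (z' ∈' x 0 ∧ opair (x 0) z' ∈' c) ↔ z' = z)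
    fun x => hun (x 0), fun s hs hne => ?_⟩
  obtain ⟨p, hp⟩ := hc (prod (upair s s) s) (by
    simp only [mem_image, mem_sep, mem_powerset]
    exact ⟨s, ⟨hs, hne⟩, rfl⟩)
  simp only [mem_prod, mem_upair, or_self, exists_eq_left] at hp
  obtain ⟨⟨z, hz, rfl⟩, hpc⟩ := (hp p).2 rfl
  have key : ∀ z', (z' ∈' s ∧ opair s z' ∈' c) ↔ z' = z := fun z' => by
    constructor
    · rintro ⟨h1, h2⟩
      exact (opair_inj.1 ((hp (opair s z')).1 ⟨⟨z', h1, rfl⟩, h2⟩)).2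
    · rintro rfl
      exact ⟨hz, hpc⟩
  dsimp only
  rw [the_eq (hun s) key]
  exact hz

end Recursion

/-! ### Relativised satisfaction, the Tarski–Vaught criterion and absoluteness. -/

section Relativization

variable {M : Type} [setLang.Structure M]

/-- Satisfaction of a formula in the domain `D`, where `∈` and `=` are interpreted by `R`
and `Q`. -/
def Sat (D : M → Prop) (R Q : M → M → Prop) : {m : ℕ} → Fm m → (Fin m → M) → Prop
  | _, .falsum, _ => False
  | _, .equal s t, a => Q (s.realize (Sum.elim default a)) (t.realize (Sum.elim default a))
  | _, .rel .mem ts, a =>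
    R ((ts 0).realize (Sum.elim default a)) ((ts 1).realize (Sum.elim default a))
  | _, .imp φ ψ, a => Sat D R Q φ a → Sat D R Q ψ a
  | _, .all φ, a => ∀ x, D x → Sat D R Q φ (Fin.snoc (α := fun _ => M) a x)

variable {D : M → Prop} {R Q : M → M → Prop} {a : Fin m → M}

theorem sat_eq {x y : Fin m} : Sat D R Q (eq x y) a ↔ Q (a x) (a y) := Iff.rfl

theorem sat_mem {x y : Fin m} : Sat D R Q (mem x y) a ↔ R (a x) (a y) := Iff.rfl

theorem sat_imp {φ ψ : Fm m} : Sat D R Q (φ ⟹ ψ) a ↔ (Sat D R Q φ a → Sat D R Q ψ a) := Iff.rfl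

theorem sat_all {φ : Fm (m + 1)} :
    Sat D R Q φ.all a ↔ ∀ x, D x → Sat D R Q φ (Fin.snoc (α := fun _ => M) a x) := Iff.rfl

theorem sat_ex {φ : Fm (m + 1)} :
    Sat D R Q φ.ex a ↔ ∃ x, D x ∧ Sat D R Q φ (Fin.snoc (α := fun _ => M) a x) := by
  have : Sat D R Q φ.ex a ↔
      ((∀ x, D x → Sat D R Q φ (Fin.snoc (α := fun _ => M) a x) → False) → False) := Iff.rfl
  rw [this]
  refine ⟨fun h => by_contra fun hn => h fun x hx h' => hn ⟨x, hx, h'⟩, ?_⟩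
  rintro ⟨x, hx, h⟩ h'
  exact h' x hx h

theorem comp_snoc {α β : Type} (c : α → β) (a : Fin m → α) (x : α) :
    (fun i => c (Fin.snoc (α := fun _ => α) a x i)) =
      Fin.snoc (α := fun _ => β) (fun i => c (a i)) (c x) := by
  funext i
  refine Fin.lastCases ?_ (fun i => ?_) i <;> simp

theorem forall_snoc {M : Type} {a : Fin m → M} {P : M → Prop} (ha : ∀ i, P (a i))
    {x : M} (hx : P x) (i : Fin (m + 1)) :
    P (Fin.snoc (α := fun _ => M) a x i) := by
  refine Fin.lastCases ?_ (fun i => ?_) i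
  · simpa using hx
  · simpa using ha i

/-- Satisfaction is preserved by (not necessarily injective) strong surjective homomorphisms. -/
theorem sat_comp {c : M → M} (hR : ∀ u v, D u → D v → (R u v ↔ c u ∈' c v))
    (hQ : ∀ u v, D u → D v → (Q u v ↔ c u = c v)) (φ : Fm m) (a : Fin m → M) (ha : ∀ i, D (a i)) :
    Sat D R Q φ a ↔ Sat (fun y => ∃ u, D u ∧ c u = y) E (· = ·) φ (fun i => c (a i)) := by
  induction φ using Fm.induction with
  | falsum => exact Iff.rfl
  | eq x y => rw [sat_eq, sat_eq, hQ _ _ (ha x) (ha y)]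
  | mem x y => rw [sat_mem, sat_mem, hR _ _ (ha x) (ha y)]
  | imp φ ψ h1 h2 => rw [sat_imp, sat_imp, h1 a ha, h2 a ha]
  | all φ h =>
    rw [sat_all, sat_all]
    constructor
    · rintro H _ ⟨u, hu, rfl⟩
      rw [← comp_snoc c, ← h _ (forall_snoc ha hu)]
      exact H u hu
    · intro H u hu
      rw [h _ (forall_snoc ha hu), comp_snoc c]
      exact H _ ⟨u, hu, rfl⟩

/-- The formulas `χ` for which `∀ x, χ` is a subformula of the given formula. -/
def quantified : {m : ℕ} → Fm m → List (Σ n, Fm (n + 1))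
  | _, .falsum => []
  | _, .equal _ _ => []
  | _, .rel _ _ => []
  | _, .imp φ ψ => quantified φ ++ quantified ψ
  | _, .all φ => ⟨_, φ⟩ :: quantified φ

/-- If `χ(a, x)` with parameters `a` in `H` has a counterexample, it has one in `H`. -/
def HasCounterexamples (H : M → Prop) (χ : Fm (n + 1)) : Prop :=
  ∀ a : Fin n → M, (∀ i, H (a i)) → (∃ z, ¬ χ.Realize default (Fin.snoc (α := fun _ => M) a z)) →
    ∃ z, H z ∧ ¬ χ.Realize default (Fin.snoc (α := fun _ => M) a z)

/-- The Tarski–Vaught criterion. -/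
theorem sat_iff_realize {H : M → Prop} (φ : Fm m)
    (hH : ∀ χ ∈ quantified φ, HasCounterexamples H χ.2) (a : Fin m → M) (ha : ∀ i, H (a i)) :
    Sat H E (· = ·) φ a ↔ φ.Realize default a := by
  induction φ using Fm.induction with
  | falsum => exact Iff.rfl
  | eq x y => exact Iff.rfl
  | mem x y => rw [sat_mem, realize_mem]
  | imp φ ψ h1 h2 =>
    rw [sat_imp, Language.BoundedFormula.realize_imp,
      h1 (fun χ h => hH χ (List.mem_append_left _ h)) a ha,
      h2 (fun χ h => hH χ (List.mem_append_right _ h)) a ha]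
  | all φ h =>
    rw [sat_all, Language.BoundedFormula.realize_all]
    have key : ∀ x, H x → _ := fun x hx =>
      h (fun χ h => hH χ (List.mem_cons_of_mem _ h)) _ (forall_snoc ha hx)
    refine ⟨fun h1 => ?_, fun h1 x hx => (key x hx).2 (h1 x)⟩
    by_contra hn
    rw [not_forall] at hn
    obtain ⟨z, hz, h2⟩ := hH ⟨_, φ⟩ List.mem_cons_self a ha hn
    exact h2 ((key z hz).1 (h1 z hz))

/-- A transitive class. -/
def IsTrans (W : M → Prop) : Prop := ∀ y z, W y → z ∈' y → W z

/-- A counterexample to `z ∈ x → χ`, or a witness for `z ∈ x ∧ χ`, is an element of the parameter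
`x`, hence belongs to the transitive class `W`. -/
theorem IsDelta0.hasCounterexamples {φ : Fm m} (h : IsDelta0 φ) {W : M → Prop} (hW : IsTrans W) :
    ∀ χ ∈ quantified φ, HasCounterexamples W χ.2 := by
  induction h with
  | falsum => exact fun χ h => (List.not_mem_nil h).elim
  | mem => exact fun χ h => (List.not_mem_nil h).elim
  | eq => exact fun χ h => (List.not_mem_nil h).elim
  | imp _ _ h1 h2 => exact fun χ h => (List.mem_append.1 h).elim (h1 χ) (h2 χ)
  | @ball n x φ _ h1 =>
    intro χ h
    rcases List.mem_cons.1 h with rfl | h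
    · rintro a ha ⟨z, hz⟩
      refine ⟨z, ?_, hz⟩
      rw [Language.BoundedFormula.realize_imp, realize_mem, Classical.not_imp] at hz
      have := hz.1
      simp only [Fin.snoc_last, Fin.snoc_castSucc] at this
      exact hW _ _ (ha x) this
    · exact (List.mem_append.1 h).elim (fun h => (List.not_mem_nil h).elim) (h1 χ)
  | @bex n x φ _ h1 =>
    intro χ h
    rcases List.mem_append.1 h with h | h
    · rcases List.mem_cons.1 h with rfl | h
      · rintro a ha ⟨z, hz⟩
        refine ⟨z, ?_, hz⟩
        rw [Language.BoundedFormula.realize_not, not_not, Language.BoundedFormula.realize_inf,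
          realize_mem] at hz
        have := hz.1
        simp only [Fin.snoc_last, Fin.snoc_castSucc] at this
        exact hW _ _ (ha x) this
      · refine h1 χ ?_
        -- The bounded existential quantifier unfolds into nested implications; the empty lists stem
        -- from `∈` and `⊥`.
        have : χ ∈ ([] ++ (quantified φ ++ []) ++ []) ++ [] := h
        simpa using this
    · exact (List.not_mem_nil h).elim

/-- A true `Σ₁`-statement about elements of `H` holds in `H` if `H` contains certain witnesses and
satisfies finitely many instances of the Tarski–Vaught criterion that hold for transitive
classes. -/
theorem IsSigma1.exists_witnesses {φ : Fm m} (h : IsSigma1 φ) (a : Fin m → M)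
    (ha : φ.Realize default a) :
    ∃ (q : List M) (l : List (Σ n, Fm (n + 1))),
      (∀ W : M → Prop, IsTrans W → ∀ χ ∈ l, HasCounterexamples W χ.2) ∧
      ∀ H : M → Prop, (∀ x ∈ q, H x) → (∀ i, H (a i)) → (∀ χ ∈ l, HasCounterexamples H χ.2) →
        Sat H E (· = ·) φ a := by
  induction h with
  | @delta0 n φ h =>
    exact ⟨[], quantified φ, fun W hW => h.hasCounterexamples hW,
      fun H _ h1 h2 => (sat_iff_realize φ h2 a h1).2 ha⟩
  | ex _ ih =>
    obtain ⟨x, hx⟩ := Language.BoundedFormula.realize_ex.1 ha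
    obtain ⟨q, l, h1, h2⟩ := ih _ hx
    refine ⟨x :: q, l, h1, fun H hq hH hl => sat_ex.2 ⟨x, hq x List.mem_cons_self, ?_⟩⟩
    exact h2 H (fun y hy => hq y (List.mem_cons_of_mem _ hy))
      (forall_snoc hH (hq x List.mem_cons_self)) hl

/-- `Σ₁`-formulas are upward absolute. -/
theorem IsSigma1.realize_of_sat {φ : Fm m} (h : IsSigma1 φ) {W : M → Prop} (hW : IsTrans W)
    (a : Fin m → M) (ha : ∀ i, W (a i)) (hs : Sat W E (· = ·) φ a) : φ.Realize default a := by
  induction h with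
  | delta0 h => exact (sat_iff_realize _ (h.hasCounterexamples hW) a ha).1 hs
  | ex _ ih =>
    obtain ⟨x, hx, h⟩ := sat_ex.1 hs
    exact Language.BoundedFormula.realize_ex.2 ⟨x, ih _ (forall_snoc ha hx) h⟩

end Relativization

/-! ### Skolem hulls enumerated by a transitive set closed under pairs. -/

section Hull

variable {M : Type} [setLang.Structure M] [hM : M ⊨ ZFC]

theorem Df.exists_fin {M : Type} [setLang.Structure M] (N : ℕ) (P : Fin N → (Fin n → M) → Prop)
    (h : ∀ i, Df (P i)) :
    Df (fun x => ∃ i, P i x) := by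
  induction N with
  | zero => exact (Df.const False).congr fun x => by simp
  | succ N ih =>
    have h0 := h 0
    have h1 := ih (fun i => P i.succ) fun i => h _
    exact (Df.or (P 0) fun x => ∃ i : Fin N, P i.succ x).congr fun x =>
      (Fin.exists_fin_succ (P := fun i => P i x)).symm

/-- Zermelo's numerals `∅, {∅}, {{∅}}, …` -/
noncomputable def numeral : ℕ → M
  | 0 => empty M
  | i + 1 => upair (numeral i) (numeral i)

theorem upair_ne_empty {x y : M} : upair x y ≠ empty M := fun h =>
  not_mem_empty (h ▸ mem_upair.2 (.inl rfl) : x ∈' empty M)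

theorem numeral_injective : Function.Injective (numeral (M := M)) := by
  intro i
  induction i with
  | zero =>
    rintro (_ | j) h
    · rfl
    · exact (upair_ne_empty h.symm).elim
  | succ i ih =>
    rintro (_ | j) h
    · exact (upair_ne_empty h).elim
    · congr 1
      refine ih ?_
      have : numeral (M := M) i ∈' numeral (j + 1) := h ▸ mem_upair.2 (.inl rfl)
      simpa [numeral] using this

/-- The value at `x` of the function given by a set of ordered pairs. -/
noncomputable def app (f x : M) : M := the fun y => ∀ z, opair x z ∈' f ↔ z = y

theorem app_unique (f x y z : M) (h : ∀ u, opair x u ∈' f ↔ u = y)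
    (h' : ∀ u, opair x u ∈' f ↔ u = z) : y = z := (h' y).1 ((h y).2 rfl)

instance (f g : (Fin n → M) → M) [hf : DfF f] [hg : DfF g] : DfF (fun x => app (f x) (g x)) :=
  DfF₂.comp (h := app) (DfF.the (fun (p : Fin 2 → M) y => ∀ z, opair (p 1) z ∈' p 0 ↔ z = y)
    fun p => app_unique (p 0) (p 1)) hf hg

theorem app_image {s x : M} {F : M → M} [hF : DfF₁ F] (hx : x ∈' s) :
    app (image s fun v => opair v (F v)) x = F x := by
  have := hF.inst
  refine the_eq (app_unique _ _) fun z => ?_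
  rw [mem_image]
  constructor
  · rintro ⟨y, hy, h⟩
    obtain ⟨rfl, rfl⟩ := opair_inj.1 h
    rfl
  · rintro rfl
    exact ⟨x, hx, rfl⟩

/-- This relation permits recursion on the components of ordered pairs, as `x ∈ {x} ∈ (x, y)` and `y
∈ {x, y} ∈ (x, y)`. For well-foundedness, foundation is applied to `Y` enlarged by the sets `v` with
`x ∈ v ∈ y` for some `x, y ∈ Y`. -/
theorem wfOn_mem_mem (D : M) : WfOn D (fun v u => ∃ w, v ∈' w ∧ w ∈' u) := by
  rintro Y - ⟨y, hy⟩
  obtain ⟨w, hw, hmin⟩ := exists_minimal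
    (x := union' Y (sep (sUnion Y) fun v => ∃ x, x ∈' Y ∧ x ∈' v)) ⟨y, mem_union'.2 (.inl hy)⟩
  simp only [mem_union', mem_sep, mem_sUnion] at hw hmin
  rcases hw with hw | ⟨-, x, hx, hxw⟩
  · refine ⟨w, hw, ?_⟩
    rintro x hx ⟨v, hxv, hvw⟩
    exact hmin v (.inr ⟨⟨w, hw, hvw⟩, x, hx, hxv⟩) hvw
  · exact (hmin x (.inl hx) hxw).elim

theorem fst_mem_mem (x y : M) : ∃ w, x ∈' w ∧ w ∈' opair x y :=
  ⟨upair x x, mem_upair.2 (.inl rfl), mem_upair.2 (.inl rfl)⟩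

theorem snd_mem_mem (x y : M) : ∃ w, y ∈' w ∧ w ∈' opair x y :=
  ⟨upair x y, mem_upair.2 (.inr rfl), mem_upair.2 (.inr rfl)⟩

/-- A transitive set that contains `∅` and is closed under pairs. -/
structure IsPairClosed (V : M) : Prop where
  trans : ∀ y z, y ∈' V → z ∈' y → z ∈' V
  empty_mem : empty M ∈' V
  upair_mem : ∀ x y, x ∈' V → y ∈' V → upair x y ∈' V

theorem IsPairClosed.opair_mem {V x y : M} (hV : IsPairClosed V) (hx : x ∈' V) (hy : y ∈' V) :
    opair x y ∈' V := hV.upair_mem _ _ (hV.upair_mem _ _ hx hx) (hV.upair_mem _ _ hx hy)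

theorem IsPairClosed.of_opair_mem {V x y : M} (hV : IsPairClosed V) (h : opair x y ∈' V) :
    x ∈' V ∧ y ∈' V := by
  obtain ⟨v, h1, h2⟩ := fst_mem_mem x y
  obtain ⟨w, h3, h4⟩ := snd_mem_mem x y
  exact ⟨hV.trans _ _ (hV.trans _ _ h h2) h1, hV.trans _ _ (hV.trans _ _ h h4) h3⟩

theorem IsPairClosed.numeral_mem {V : M} (hV : IsPairClosed V) (i : ℕ) : numeral i ∈' V := by
  induction i with
  | zero => exact hV.empty_mem
  | succ i ih => exact hV.upair_mem _ _ ih ih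

theorem opair_ne_empty (x y : M) : opair x y ≠ empty M := upair_ne_empty

theorem opair_ne_one (x y : M) : opair x y ≠ numeral 1 := fun h => by
  have : upair x x ∈' numeral 1 := h ▸ mem_upair.2 (.inl rfl)
  simp only [numeral, mem_upair, or_self] at this
  exact upair_ne_empty this

theorem fst_eq_empty {u : M} (h : ∀ x y, u ≠ opair x y) : fst u = empty M :=
  the_eq_empty fun x ⟨y, hy⟩ => h x y hy

theorem snd_eq_empty {u : M} (h : ∀ x y, u ≠ opair x y) : snd u = empty M :=
  the_eq_empty fun y ⟨x, hx⟩ => h x y hx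

open Classical in
/-- A surjection from `V` onto a subset of `W` that contains `V` and is closed under pairs and
under the definable function `g`. -/
theorem IsPairClosed.exists_enumeration {V W : M} (hV : IsPairClosed V) (hW : IsPairClosed W)
    (hVW : V ⊆' W) (g : M → M) (hg : DfF₁ g) (hgW : ∀ t, g t ∈' W) :
    ∃ e : M → M, DfF₁ e ∧ (∀ u, u ∈' V → e u ∈' W) ∧
      (∀ x, x ∈' V → e (opair (empty M) x) = x) ∧
      (∀ u, u ∈' V → ∃ v, v ∈' V ∧ e v = g (e u)) ∧
      (∀ u v, u ∈' V → v ∈' V → ∃ w, w ∈' V ∧ e w = opair (e u) (e v)) := by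
  have := hg.inst
  -- Elements of `V` are read as terms: `(∅, x)` denotes `x`, `(1, x)` denotes `g` of the value of
  -- `x`, and any other pair denotes the pair of the two values.
  obtain ⟨e, he, hrec⟩ := (wfOn_mem_mem V).exists_recursion (by infer_instance)
    (fun u f => if fst u = empty M then snd u else if fst u = numeral 1 then g (app f (snd u)) else
      opair (app f (fst u)) (app f (snd u))) inferInstance
  have := he.inst
  have h0 : ∀ x, x ∈' V → e (opair (empty M) x) = x := fun x hx => by
    rw [hrec _ (hV.opair_mem hV.empty_mem hx)]
    simp
  -- Both components of a non-pair are `∅` by default, so the first case applies and gives the value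
  -- `∅`.
  have hnp : ∀ u, u ∈' V → (∀ x y, u ≠ opair x y) → e u = empty M := fun u hu h => by
    rw [hrec u hu, if_pos (fst_eq_empty h), snd_eq_empty h]
  have hne : numeral 1 ≠ empty M := upair_ne_empty
  have h1 : ∀ x, x ∈' V → e (opair (numeral 1) x) = g (e x) := fun x hx => by
    rw [hrec _ (hV.opair_mem (hV.numeral_mem 1) hx), fst_opair, snd_opair, if_neg hne, if_pos rfl,
      app_image (mem_sep.2 ⟨hx, snd_mem_mem _ _⟩)]
  have h2 : ∀ x y, x ∈' V → y ∈' V → x ≠ empty M → x ≠ numeral 1 →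
      e (opair x y) = opair (e x) (e y) := fun x y hx hy hx0 hx1 => by
    rw [hrec _ (hV.opair_mem hx hy), fst_opair, snd_opair, if_neg hx0, if_neg hx1,
      app_image (mem_sep.2 ⟨hx, fst_mem_mem _ _⟩), app_image (mem_sep.2 ⟨hy, snd_mem_mem _ _⟩)]
  refine ⟨e, he, ?_, h0, fun u hu => ⟨_, hV.opair_mem (hV.numeral_mem 1) hu, h1 u hu⟩,
    fun u v hu hv => ?_⟩
  · refine (wfOn_mem_mem V).induction (fun u => e u ∈' W) fun u hu ih => ?_
    by_cases hp : ∃ x y, u = opair x y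
    · obtain ⟨x, y, rfl⟩ := hp
      obtain ⟨hx, hy⟩ := hV.of_opair_mem hu
      by_cases hx0 : x = empty M
      · rw [hx0, h0 y hy]
        exact hVW y hy
      · by_cases hx1 : x = numeral 1
        · rw [hx1, h1 y hy]
          exact hgW _
        · rw [h2 x y hx hy hx0 hx1]
          exact hW.opair_mem (ih x hx (fst_mem_mem _ _)) (ih y hy (snd_mem_mem _ _))
    · rw [hnp u hu fun x y h => hp ⟨x, y, h⟩]
      exact hW.empty_mem
  -- The term `(u, v)` has a different meaning if `u` is `∅` or `1`. Neither is an ordered pair, and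
  -- a non-pair has the value `∅`, so `(∅, ∅)` can take its place.
  · have : ∃ u', u' ∈' V ∧ e u' = e u ∧ u' ≠ empty M ∧ u' ≠ numeral 1 := by
      by_cases hp : ∃ x y, u = opair x y
      · obtain ⟨x, y, rfl⟩ := hp
        exact ⟨_, hu, rfl, opair_ne_empty _ _, opair_ne_one _ _⟩
      · refine ⟨opair (empty M) (empty M), hV.opair_mem hV.empty_mem hV.empty_mem, ?_,
          opair_ne_empty _ _, opair_ne_one _ _⟩
        rw [h0 _ hV.empty_mem, hnp u hu fun x y h => hp ⟨x, y, h⟩]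
    obtain ⟨u', hu', h, hu0, hu1⟩ := this
    exact ⟨_, hV.opair_mem hu' hv, by rw [h2 u' v hu' hv hu0 hu1, h]⟩

open Classical in
/-- The downward Löwenheim–Skolem argument: a surjection from `V` onto a subset of `W` that
contains `V`, is closed under pairs, and contains witnesses in `W` for the definable relations
`S i`. -/
theorem IsPairClosed.exists_hull {V W : M} (hV : IsPairClosed V) (hW : IsPairClosed W)
    (hVW : V ⊆' W) {N : ℕ} (S : Fin N → M → M → Prop) (hS : ∀ i, Df₂ (S i)) :
    ∃ e : M → M, DfF₁ e ∧ (∀ u, u ∈' V → e u ∈' W) ∧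
      (∀ x, x ∈' V → e (opair (empty M) x) = x) ∧
      (∀ u v, u ∈' V → v ∈' V → ∃ w, w ∈' V ∧ e w = opair (e u) (e v)) ∧
      ∀ i u, u ∈' V → (∃ z, z ∈' W ∧ S i (e u) z) → ∃ v, v ∈' V ∧ S i (e u) (e v) := by
  -- All relations are merged into one: a request `t = (i, s)` asks for some `z` with `S i s z`, so
  -- a single function `g` answers all requests.
  have hT : Df₂ fun t z => ∃ i : Fin N, fst t = numeral i ∧ S i (snd t) z := by
    refine Df.exists_fin N _ fun i => ?_
    have := (hS i).inst
    infer_instance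
  have := hT.inst
  obtain ⟨c, hc, hcW⟩ := exists_choiceFunction W
  have := hc.inst
  let T : M → M := fun t => sep W fun z => ∃ i : Fin N, fst t = numeral i ∧ S i (snd t) z
  have hTd : DfF₁ T := by unfold T; infer_instance
  have := hTd.inst
  have hTc : ∀ t, (∃ z, z ∈' T t) → c (T t) ∈' T t := fun t => hcW _ fun z hz => (mem_sep.1 hz).1
  obtain ⟨e, he, heW, he0, heg, hep⟩ := hV.exists_enumeration hW hVW
    (fun t => if ∃ z, z ∈' T t then c (T t) else empty M) (by infer_instance) (fun t => by
      split_ifs with h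
      · exact (mem_sep.1 (hTc t h)).1
      · exact hW.empty_mem)
  refine ⟨e, he, heW, he0, hep, fun i u hu ⟨z, hz, hSz⟩ => ?_⟩
  -- The request `(i, e u)` is itself a value of `e`, because numerals lie in `V` and the range is
  -- closed under pairs.
  obtain ⟨w, hw, hwe⟩ := hep _ u (hV.opair_mem hV.empty_mem (hV.numeral_mem i)) hu
  rw [he0 _ (hV.numeral_mem i)] at hwe
  obtain ⟨v, hv, hve⟩ := heg w hw
  have hne : ∃ z, z ∈' T (e w) :=
    ⟨z, mem_sep.2 ⟨hz, i, by rw [hwe, fst_opair], by rwa [hwe, snd_opair]⟩⟩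
  rw [if_pos hne] at hve
  obtain ⟨-, j, hj, hSj⟩ := mem_sep.1 (hTc _ hne)
  rw [hwe, fst_opair] at hj
  obtain rfl := Fin.ext (numeral_injective hj)
  refine ⟨v, hv, ?_⟩
  rw [hve]
  rwa [hwe, snd_opair, ← hwe] at hSj

end Hull

/-! ### Coding transitive structures by subsets of `V`. -/

section Coding

variable {M : Type} [setLang.Structure M]

/-- `u` and `v` have the same `R`-predecessors in `V`. -/
def SamePreds (V : M) (R : M → M → Prop) (u v : M) : Prop := ∀ z, z ∈' V → (R z u ↔ R z v)

variable [hM : M ⊨ ZFC]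

/-- The `R`-predecessors of `a` in `V` are the codes of the elements of `A`, where `x` has the code
`(∅, x)`. -/
def IsCodeOf (V : M) (R : M → M → Prop) (a A : M) : Prop :=
  ∀ z, z ∈' V → (R z a ↔ ∃ x, x ∈' V ∧ x ∈' A ∧ SamePreds V R z (opair (empty M) x))

/-- The relation `R` on `V`, modulo `SamePreds`, is isomorphic to the membership relation of a
transitive set that contains the elements `x` of `V`, with codes `(∅, x)`. -/
structure IsCoding (V : M) (R : M → M → Prop) : Prop where
  wf : WfOn V R
  congr : ∀ x x' y, x ∈' V → x' ∈' V → y ∈' V → SamePreds V R x x' → R x y → R x' y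
  base : ∀ y, y ∈' V → IsCodeOf V R (opair (empty M) y) y

/-- The Mostowski collapse of a coding. -/
theorem IsCoding.exists_collapse {V : M} {R : M → M → Prop} (h : IsCoding V R) (hR : Df₂ R)
    (hV : IsPairClosed V) :
    ∃ c : M → M, (∀ u z, u ∈' V → (z ∈' c u ↔ ∃ v, v ∈' V ∧ R v u ∧ c v = z)) ∧
      (∀ u v, u ∈' V → v ∈' V → (R u v ↔ c u ∈' c v)) ∧
      (∀ u v, u ∈' V → v ∈' V → (SamePreds V R u v ↔ c u = c v)) ∧
      ∀ a A, a ∈' V → A ⊆' V → IsCodeOf V R a A → c a = A := by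
  have := hR.inst
  -- The collapse `c u = {c v | v ∈ V, R v u}`.
  obtain ⟨c, hc, hrec⟩ := h.wf.exists_recursion hR (fun _ f => image f snd) inferInstance
  have := hc.inst
  have memc : ∀ u z, u ∈' V → (z ∈' c u ↔ ∃ v, v ∈' V ∧ R v u ∧ c v = z) := fun u z hu => by
    rw [hrec u hu]
    simp [and_assoc]
  have hcongr : ∀ u v, u ∈' V → v ∈' V → SamePreds V R u v → c u = c v := fun u v hu hv huv =>
    ext fun z => by
      rw [memc u z hu, memc v z hv]
      exact exists_congr fun w => and_congr_right fun hw => by rw [huv w hw]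
  -- If `c u = c v` and `R z u`, then `c z = c w` for some `w` with `R w v`. By induction `z` and
  -- `w` have the same predecessors, and `IsCoding.congr` gives `R z v`.
  have hinj : ∀ u, u ∈' V → ∀ v, v ∈' V → c u = c v → SamePreds V R u v := by
    refine h.wf.induction (fun u => ∀ v, v ∈' V → c u = c v → SamePreds V R u v)
      (hP := by unfold SamePreds; infer_instance) fun u hu ih v hv huv z hz =>
        ⟨fun hzu => ?_, fun hzv => ?_⟩
    · obtain ⟨w, hw, hwv, hwz⟩ := (memc v _ hv).1 (huv ▸ (memc u (c z) hu).2 ⟨z, hz, hzu, rfl⟩)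
      exact h.congr w z v hw hz hv (fun x hx => (ih z hz hzu w hw hwz.symm x hx).symm) hwv
    · obtain ⟨w, hw, hwu, hwz⟩ := (memc u _ hu).1 (huv ▸ (memc v (c z) hv).2 ⟨z, hz, hzv, rfl⟩)
      exact h.congr w z u hw hz hu (ih w hw hwu z hz hwz) hwu
  have hcode : ∀ a A, a ∈' V → A ⊆' V → IsCodeOf V R a A →
      (∀ x, x ∈' A → c (opair (empty M) x) = x) → c a = A := by
    intro a A ha hA hcode hx
    refine ext fun z => ?_
    rw [memc a z ha]
    constructor
    · rintro ⟨v, hv, hva, rfl⟩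
      obtain ⟨x, hxV, hxA, hvx⟩ := (hcode v hv).1 hva
      rw [hcongr _ _ hv (hV.opair_mem hV.empty_mem hxV) hvx, hx x hxA]
      exact hxA
    · intro hz
      have hp := hV.opair_mem hV.empty_mem (hA z hz)
      exact ⟨_, hp, (hcode _ hp).2 ⟨z, hA z hz, hz, fun _ _ => Iff.rfl⟩, hx z hz⟩
  -- By `∈`-induction on `y`, as the predecessors of `(∅, y)` are exactly the codes of elements of
  -- `y`.
  have hbase : ∀ y, y ∈' V → c (opair (empty M) y) = y := by
    refine (wfOn_mem V).induction (fun y => c (opair (empty M) y) = y) fun y hy ih => ?_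
    exact hcode _ y (hV.opair_mem hV.empty_mem hy) (fun z hz => hV.trans y z hy hz) (h.base y hy)
      fun x hx => ih x (hV.trans y x hy hx) hx
  refine ⟨c, memc, fun u v hu hv => ⟨fun huv => (memc v _ hv).2 ⟨u, hu, huv, rfl⟩, fun huv => ?_⟩,
    fun u v hu hv => ⟨hcongr u v hu hv, hinj u hu v hv⟩,
    fun a A ha hA h => hcode a A ha hA h fun x hx => hbase x (hA x hx)⟩
  obtain ⟨w, hw, hwv, hwu⟩ := (memc v _ hv).1 huv
  exact h.congr w u v hw hu hv (hinj w hw u hu hwu) hwv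

/-- The collapse is a strong homomorphism onto a transitive class and takes `a i` to `A i`; from
that class `Σ₁`-formulas go up. -/
theorem IsCoding.realize_of_sat {V : M} {R : M → M → Prop} (h : IsCoding V R) (hR : Df₂ R)
    (hV : IsPairClosed V) {φ : Fm k} (hφ : IsSigma1 φ) {A a : Fin k → M} (hA : ∀ i, A i ⊆' V)
    (ha : ∀ i, a i ∈' V) (hcode : ∀ i, IsCodeOf V R (a i) (A i))
    (hs : Sat (· ∈' V) R (SamePreds V R) φ a) : φ.Realize default A := by
  obtain ⟨c, memc, hcR, hcQ, hc⟩ := h.exists_collapse hR hV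
  rw [sat_comp hcR hcQ φ a ha] at hs
  have hca : (fun i => c (a i)) = A := funext fun i => hc _ _ (ha i) (hA i) (hcode i)
  rw [hca] at hs
  refine hφ.realize_of_sat ?_ A (fun i => ⟨a i, ha i, congrFun hca i⟩) hs
  rintro _ z ⟨u, hu, rfl⟩ hz
  obtain ⟨v, hv, -, h⟩ := (memc u z hu).1 hz
  exact ⟨v, hv, h⟩

/-- The tuple of length `n` coded by nested pairs. -/
noncomputable def tuple : {n : ℕ} → (Fin n → M) → M
  | 0, _ => empty M
  | _ + 1, a => opair (tuple fun i => a i.castSucc) (a (Fin.last _))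

/-- The entries of a coded tuple. -/
noncomputable def untuple : (n : ℕ) → M → Fin n → M
  | 0, _ => Fin.elim0
  | n + 1, t => Fin.snoc (α := fun _ => M) (untuple n (fst t)) (snd t)

theorem untuple_tuple (a : Fin n → M) : untuple n (tuple a) = a := by
  induction n with
  | zero => exact Subsingleton.elim _ _
  | succ n ih =>
    rw [untuple, tuple, fst_opair, snd_opair, ih]
    exact Fin.snoc_init_self a

theorem untuple_definable (f : (Fin m → M) → M) [hf : DfF f] (i : Fin n) :
    DfF (fun x => untuple n (f x) i) := by
  induction n generalizing f with
  | zero => exact i.elim0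
  | succ n ih =>
    refine Fin.lastCases ?_ (fun i => ?_) i
    · simp only [untuple, Fin.snoc_last]
      infer_instance
    · simp only [untuple, Fin.snoc_castSucc]
      exact ih (fun x => fst (f x)) i

/-- The converse of `IsCoding.realize_of_sat`. A hull of `V` inside a transitive set `W` is the
range of a function `e` on `V`, and `X` is the membership relation pulled back along `e`. The hull
need not be transitive, but it is extensional, so "same predecessors" means equality of values. -/
theorem IsPairClosed.exists_coding {V w : M} (hV : IsPairClosed V) (hw : IsLinearLimit w)
    {φ : Fm k} (hφ : IsSigma1 φ) {A : Fin k → M} (hA : φ.Realize default A) (hAV : ∀ i, A i ⊆' V) :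
    ∃ X, X ⊆' V ∧ IsCoding V (fun u v => opair u v ∈' X) ∧
      ∃ a : Fin k → M, (∀ i, a i ∈' V) ∧
        (∀ i, IsCodeOf V (fun u v => opair u v ∈' X) (a i) (A i)) ∧
        Sat (· ∈' V) (fun u v => opair u v ∈' X) (SamePreds V fun u v => opair u v ∈' X) φ a := by
  obtain ⟨q₀, l, hl, hq₀⟩ := hφ.exists_witnesses A hA
  let q := q₀ ++ List.ofFn A
  obtain ⟨x₀, hx₀⟩ : ∃ x₀ : M, V ⊆' x₀ ∧ ∀ x ∈ q, x ∈' x₀ := by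
    induction q with
    | nil => exact ⟨V, fun _ h => h, by simp⟩
    | cons x q ih =>
      obtain ⟨x₀, h1, h2⟩ := ih
      refine ⟨union' x₀ (upair x x), fun z hz => mem_union'.2 (.inl (h1 z hz)), fun y hy => ?_⟩
      rcases List.mem_cons.1 hy with rfl | hy
      · simp
      · exact mem_union'.2 (.inl (h2 y hy))
  obtain ⟨W, hxW, hWt, hWp⟩ := hw.exists_closure x₀
  have hVW : V ⊆' W := fun z hz => hxW z (hx₀.1 z hz)
  have hW : IsPairClosed W := ⟨hWt, hVW _ hV.empty_mem, hWp⟩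
  -- Three kinds of requests: the members of `q`; an element that distinguishes two given sets, for
  -- extensionality of the hull; counterexamples to the formulas in `l`, with the parameters coded
  -- as one tuple.
  obtain ⟨e, he, heW, he0, hep, heS⟩ := hV.exists_hull hW hVW (N := q.length + (1 + l.length))
    (Fin.append (fun i _ z => z = q.get i) (Fin.append
      (fun _ t z => ¬ (z ∈' fst t ↔ z ∈' snd t))
      (fun i t z => ¬ (l.get i).2.Realize default
        (Fin.snoc (α := fun _ => M) (untuple (l.get i).1 t) z)))) (by
    refine Fin.addCases (fun i => ?_) (Fin.addCases (fun i => ?_) fun i => ?_)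
    · simp only [Fin.append_left]
      infer_instance
    · simp only [Fin.append_left, Fin.append_right]
      infer_instance
    · simp only [Fin.append_right]
      have : Df (fun x : Fin 2 → M => (l.get i).2.Realize default
        (Fin.snoc (α := fun _ => M) (untuple (l.get i).1 (x 0)) (x 1))) := by
        refine (Df.comp (Df.realize (l.get i).2) (Fin.snoc (α := fun _ => (Fin 2 → M) → M)
          (fun j x => untuple (l.get i).1 (x 0) j) fun x => x 1) fun j => ?_).congr fun x => ?_
        · refine Fin.lastCases ?_ (fun j => ?_) j
          · simp only [Fin.snoc_last]
            infer_instance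
          · simp only [Fin.snoc_castSucc]
            exact untuple_definable _ _
        · refine iff_of_eq (congrArg _ (funext fun j => ?_))
          refine Fin.lastCases ?_ (fun j => ?_) j <;> simp
      infer_instance)
  have := he.inst
  let H : M → Prop := fun y => ∃ u, u ∈' V ∧ e u = y
  have hHq : ∀ x ∈ q, H x := fun x hx => by
    obtain ⟨i, rfl⟩ := List.get_of_mem hx
    have := heS (i.castAdd _) _ hV.empty_mem
    simp only [Fin.append_left, exists_eq_right] at this
    exact this (hxW _ (hx₀.2 _ hx))
  have hHext : ∀ u v, u ∈' V → v ∈' V → (∀ z, z ∈' V → (e z ∈' e u ↔ e z ∈' e v)) → e u = e v := by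
    intro u v hu hv h
    by_contra hne
    obtain ⟨p, hp, hpe⟩ := hep u v hu hv
    have hS := heS (Fin.natAdd _ (Fin.castAdd _ 0)) p hp
    simp only [Fin.append_left, Fin.append_right, hpe, fst_opair, snd_opair] at hS
    have hz : ∃ z, ¬ (z ∈' e u ↔ z ∈' e v) := by
      by_contra hz
      rw [not_exists_not] at hz
      exact hne (ext hz)
    obtain ⟨z, hz⟩ := hz
    obtain ⟨x, hx, h'⟩ := hS ⟨z, by
      by_cases h1 : z ∈' e u
      · exact hWt _ _ (heW u hu) h1
      · by_cases h2 : z ∈' e v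
        · exact hWt _ _ (heW v hv) h2
        · exact (hz (iff_of_false h1 h2)).elim, hz⟩
    exact h' (h x hx)
  have htup : ∀ (n : ℕ) (a : Fin n → M), (∀ i, H (a i)) → H (tuple a) := by
    intro n
    induction n with
    | zero => exact fun a _ => ⟨_, hV.opair_mem hV.empty_mem hV.empty_mem, he0 _ hV.empty_mem⟩
    | succ n ih =>
      intro a ha
      obtain ⟨u, hu, hue⟩ := ih (fun i => a i.castSucc) fun i => ha _
      obtain ⟨v, hv, hve⟩ := ha (Fin.last n)
      obtain ⟨p, hp, hpe⟩ := hep u v hu hv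
      exact ⟨p, hp, by rw [hpe, hue, hve, tuple]⟩
  -- Counterexamples exist in `W` since it is transitive, and the hull contains one whenever `W`
  -- does.
  have hHl : ∀ χ ∈ l, HasCounterexamples H χ.2 := fun χ hχ a ha hz => by
    obtain ⟨i, rfl⟩ := List.get_of_mem hχ
    obtain ⟨p, hp, hpe⟩ := htup _ a ha
    have hS := heS (Fin.natAdd _ (Fin.natAdd _ i)) p hp
    simp only [Fin.append_right, hpe, untuple_tuple] at hS
    obtain ⟨v, hv, h⟩ := hS (hl (· ∈' W) hWt _ hχ a (fun i => by
      obtain ⟨u, hu, h⟩ := ha i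
      exact h ▸ heW u hu) hz)
    exact ⟨_, ⟨v, hv, rfl⟩, h⟩
  have hAq : ∀ i, H (A i) := fun i =>
    hHq _ (List.mem_append_right _ ((List.mem_ofFn' A _).2 ⟨i, rfl⟩))
  have hsat := hq₀ H (fun x hx => hHq x (List.mem_append_left _ hx)) hAq hHl
  choose a ha hae using hAq
  refine ⟨sep V fun p => e (fst p) ∈' e (snd p), fun z hz => (mem_sep.1 hz).1, ?_⟩
  -- Only the equivalence `hR` is needed below, so the relation given by `X` is made opaque.
  obtain ⟨R, hRdef⟩ : ∃ R : M → M → Prop, R = fun u v => opair u v ∈'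
    sep V (fun p => e (fst p) ∈' e (snd p)) := ⟨_, rfl⟩
  have hR : ∀ u v, u ∈' V → v ∈' V → (R u v ↔ e u ∈' e v) := fun u v hu hv => by
    simp only [hRdef]
    rw [mem_sep, fst_opair, snd_opair, and_iff_right (hV.opair_mem hu hv)]
  rw [← hRdef]
  clear hRdef
  have hQ : ∀ u v, u ∈' V → v ∈' V → (SamePreds V R u v ↔ e u = e v) := fun u v hu hv => by
    refine ⟨fun h => hHext u v hu hv fun z hz => ?_, fun h z hz => ?_⟩
    · rw [← hR z u hz hu, ← hR z v hz hv]
      exact h z hz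
    · rw [hR z u hz hu, hR z v hz hv, h]
  have hcode : ∀ a A, a ∈' V → A ⊆' V → e a = A → IsCodeOf V R a A := by
    rintro a _ ha hA rfl z hz
    rw [hR z a hz ha]
    constructor
    · intro h
      have hzV := hA _ h
      refine ⟨_, hzV, h, (hQ _ _ hz (hV.opair_mem hV.empty_mem hzV)).2 (he0 _ hzV).symm⟩
    · rintro ⟨x, hx, hxa, h⟩
      rw [(hQ _ _ hz (hV.opair_mem hV.empty_mem hx)).1 h, he0 x hx]
      exact hxa
  refine ⟨⟨?_, ?_, ?_⟩, a, ha, fun i => hcode _ _ (ha i) (hAV i) (hae i), ?_⟩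
  -- A preimage of an `∈`-minimal element of the image of `Y` under `e` is minimal in `Y`.
  · rintro Y hY ⟨y, hy⟩
    obtain ⟨_, h1, h2⟩ := exists_minimal (x := image Y e) ⟨_, mem_image.2 ⟨y, hy, rfl⟩⟩
    obtain ⟨u, hu, rfl⟩ := mem_image.1 h1
    refine ⟨u, hu, fun v hv hvu => ?_⟩
    rw [hR v u (hY v hv) (hY u hu)] at hvu
    exact h2 _ (mem_image.2 ⟨v, hv, rfl⟩) hvu
  · intro x x' y hx hx' hy hxx' h
    rw [hR _ _ hx hy] at h
    rw [hR _ _ hx' hy, ← (hQ _ _ hx hx').1 hxx']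
    exact h
  · exact fun y hy => hcode _ y (hV.opair_mem hV.empty_mem hy) (fun z hz => hV.trans y z hy hz)
      (he0 y hy)
  · rw [sat_comp hR hQ φ a ha]
    simp only [hae]
    exact hsat

end Coding

/-! ### Second-order formulas -/

namespace SOFm

/-- `¬ φ` -/
protected def not (φ : SOFm m n) : SOFm m n := .imp φ .falsum

/-- `φ ∧ ψ` -/
protected def and (φ ψ : SOFm m n) : SOFm m n := (φ.imp ψ.not).not

/-- `φ ∨ ψ` -/
protected def or (φ ψ : SOFm m n) : SOFm m n := φ.not.imp ψ

/-- `φ ↔ ψ` -/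
protected def iff (φ ψ : SOFm m n) : SOFm m n := (φ.imp ψ).and (ψ.imp φ)

/-- `∃ x, φ` for a first-order variable `x` -/
def ex₁ (φ : SOFm m (n + 1)) : SOFm m n := φ.not.all₁.not

/-- `∀ z, f z` -/
def allS (f : Fin (n + 1) → SOFm m (n + 1)) : SOFm m n := (f (Fin.last n)).all₁

/-- `∃ z, f z` -/
def exS (f : Fin (n + 1) → SOFm m (n + 1)) : SOFm m n := (f (Fin.last n)).ex₁

/-- The conjunction of a list of formulas. -/
def conj : List (SOFm m n) → SOFm m n
  | [] => SOFm.not .falsum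
  | φ :: l => φ.and (conj l)

/-- Existential quantification over all first-order variables. -/
def exs : {n : ℕ} → SOFm m n → SOFm m 0
  | 0, φ => φ
  | _ + 1, φ => exs φ.ex₁

section NoSOQuant

variable {φ ψ : SOFm m n}

theorem NoSOQuant.not (h : φ.NoSOQuant) : φ.not.NoSOQuant := .imp h .falsum

theorem NoSOQuant.and (h : φ.NoSOQuant) (h' : ψ.NoSOQuant) : (φ.and ψ).NoSOQuant :=
  (NoSOQuant.imp h h'.not).not

theorem NoSOQuant.or (h : φ.NoSOQuant) (h' : ψ.NoSOQuant) : (φ.or ψ).NoSOQuant := .imp h.not h'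

theorem NoSOQuant.iff (h : φ.NoSOQuant) (h' : ψ.NoSOQuant) : (φ.iff ψ).NoSOQuant :=
  (NoSOQuant.imp h h').and (.imp h' h)

theorem NoSOQuant.ex₁ {φ : SOFm m (n + 1)} (h : φ.NoSOQuant) : φ.ex₁.NoSOQuant :=
  (NoSOQuant.all₁ h.not).not

theorem NoSOQuant.allS {f : Fin (n + 1) → SOFm m (n + 1)} (h : ∀ x, (f x).NoSOQuant) :
    (SOFm.allS f).NoSOQuant := .all₁ (h _)

theorem NoSOQuant.exS {f : Fin (n + 1) → SOFm m (n + 1)} (h : ∀ x, (f x).NoSOQuant) :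
    (SOFm.exS f).NoSOQuant := (h _).ex₁

theorem NoSOQuant.conj {l : List (SOFm m n)} (h : ∀ φ ∈ l, φ.NoSOQuant) :
    (SOFm.conj l).NoSOQuant := by
  induction l with
  | nil => exact NoSOQuant.falsum.not
  | cons φ l ih =>
    exact (h φ List.mem_cons_self).and (ih fun ψ hψ => h ψ (List.mem_cons_of_mem _ hψ))

theorem NoSOQuant.exs {n : ℕ} {φ : SOFm m n} (h : φ.NoSOQuant) : φ.exs.NoSOQuant := by
  induction n with
  | zero => exact h
  | succ n ih => exact ih h.ex₁

end NoSOQuant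

section Semantics

variable {M : Type} [setLang.Structure M]

/-- The meaning of `⟨D, ∈⟩ ⊨ φ(A; a)`. -/
def Sem (D : M) : {m n : ℕ} → SOFm m n → (Fin m → M) → (Fin n → M) → Prop
  | _, _, .falsum, _, _ => False
  | _, _, .mem x y, _, a => a x ∈' a y
  | _, _, .eq x y, _, a => a x = a y
  | _, _, .app X x, A, a => a x ∈' A X
  | _, _, .imp φ ψ, A, a => φ.Sem D A a → ψ.Sem D A a
  | _, _, .all₁ φ, A, a => ∀ x, x ∈' D → φ.Sem D A (Fin.snoc (α := fun _ => M) a x)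
  | _, _, .all₂ φ, A, a => ∀ X, X ⊆' D → φ.Sem D (Fin.snoc (α := fun _ => M) A X) a

theorem realize_sat (φ : SOFm m n) {N : ℕ} (D : Fin N) (A : Fin m → Fin N) (a : Fin n → Fin N)
    {v : Empty → M} (xs : Fin N → M) : (φ.sat D A a).Realize v xs ↔
      φ.Sem (xs D) (fun i => xs (A i)) (fun i => xs (a i)) := by
  induction φ generalizing N with
  | falsum => exact Iff.rfl
  | mem x y => exact realize_mem
  | eq x y => exact realize_eq
  | app X x => exact realize_mem
  | imp φ ψ h1 h2 =>
    simp only [SOFm.sat, Sem, Language.BoundedFormula.realize_imp, h1, h2]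
  | all₁ φ h =>
    simp only [SOFm.sat, Sem, realize_allF, Language.BoundedFormula.realize_imp, h, realize_mem,
      snoc_push, Fin.snoc_last, Fin.snoc_castSucc]
  | all₂ φ h =>
    simp only [SOFm.sat, Sem, realize_allF, Language.BoundedFormula.realize_imp, h, realize_subset,
      snoc_push, Fin.snoc_last, Fin.snoc_castSucc]

variable {D : M} {A : Fin m → M} {a : Fin n → M} {φ ψ : SOFm m n}

theorem sem_mem {x y : Fin n} : (SOFm.mem x y).Sem D A a ↔ a x ∈' a y := Iff.rfl

theorem sem_eq {x y : Fin n} : (SOFm.eq x y).Sem D A a ↔ a x = a y := Iff.rfl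

theorem sem_app {X : Fin m} {x : Fin n} : (SOFm.app X x).Sem D A a ↔ a x ∈' A X := Iff.rfl

theorem sem_imp : (φ.imp ψ).Sem D A a ↔ (φ.Sem D A a → ψ.Sem D A a) := Iff.rfl

theorem sem_not : φ.not.Sem D A a ↔ ¬ φ.Sem D A a := Iff.rfl

theorem sem_and : (φ.and ψ).Sem D A a ↔ φ.Sem D A a ∧ ψ.Sem D A a := by
  simp only [SOFm.and, sem_not, sem_imp]
  tauto

theorem sem_or : (φ.or ψ).Sem D A a ↔ φ.Sem D A a ∨ ψ.Sem D A a := by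
  simp only [SOFm.or, sem_not, sem_imp]
  tauto

theorem sem_iff : (φ.iff ψ).Sem D A a ↔ (φ.Sem D A a ↔ ψ.Sem D A a) := by
  simp only [SOFm.iff, sem_and, sem_imp]
  tauto

theorem sem_all₁ {φ : SOFm m (n + 1)} :
    φ.all₁.Sem D A a ↔ ∀ x, x ∈' D → φ.Sem D A (Fin.snoc (α := fun _ => M) a x) := Iff.rfl

theorem sem_ex₁ {φ : SOFm m (n + 1)} :
    φ.ex₁.Sem D A a ↔ ∃ x, x ∈' D ∧ φ.Sem D A (Fin.snoc (α := fun _ => M) a x) := by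
  simp only [ex₁, sem_not, sem_all₁, not_forall, not_not, exists_prop]

theorem sem_allS {f : Fin (n + 1) → SOFm m (n + 1)} : (allS f).Sem D A a ↔
    ∀ x, x ∈' D → (f (Fin.last n)).Sem D A (Fin.snoc (α := fun _ => M) a x) := Iff.rfl

theorem sem_exS {f : Fin (n + 1) → SOFm m (n + 1)} : (exS f).Sem D A a ↔
    ∃ x, x ∈' D ∧ (f (Fin.last n)).Sem D A (Fin.snoc (α := fun _ => M) a x) := sem_ex₁

theorem sem_all₂ {φ : SOFm (m + 1) n} :
    φ.all₂.Sem D A a ↔ ∀ X, X ⊆' D → φ.Sem D (Fin.snoc (α := fun _ => M) A X) a := Iff.rfl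

theorem sem_ex₂ {φ : SOFm (m + 1) n} :
    φ.ex₂.Sem D A a ↔ ∃ X, X ⊆' D ∧ φ.Sem D (Fin.snoc (α := fun _ => M) A X) a := by
  have : φ.ex₂.Sem D A a ↔
      ((∀ X, X ⊆' D → φ.Sem D (Fin.snoc (α := fun _ => M) A X) a → False) → False) := Iff.rfl
  rw [this]
  refine ⟨fun h => by_contra fun hn => h fun x hx h' => hn ⟨x, hx, h'⟩, ?_⟩
  rintro ⟨x, hx, h⟩ h'
  exact h' x hx h

theorem sem_conj {l : List (SOFm m n)} : (conj l).Sem D A a ↔ ∀ φ ∈ l, φ.Sem D A a := by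
  induction l with
  | nil => exact iff_of_true (fun h => h) (by simp)
  | cons φ l ih => simp only [conj, sem_and, ih, List.forall_mem_cons]

theorem sem_exs {n : ℕ} {φ : SOFm m n} :
    φ.exs.Sem D A Fin.elim0 ↔ ∃ a : Fin n → M, (∀ i, a i ∈' D) ∧ φ.Sem D A a := by
  induction n with
  | zero =>
    refine ⟨fun h => ⟨Fin.elim0, fun i => i.elim0, h⟩, fun ⟨a, _, h⟩ => ?_⟩
    rwa [Subsingleton.elim a Fin.elim0] at h
  | succ n ih =>
    rw [exs, ih]
    simp only [sem_ex₁]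
    constructor
    · rintro ⟨a, ha, x, hx, h⟩
      exact ⟨_, forall_snoc (P := fun x => x ∈' D) ha hx, h⟩
    · rintro ⟨a, ha, h⟩
      refine ⟨fun i => a i.castSucc, fun i => ha _, a (Fin.last n), ha _, ?_⟩
      rwa [show Fin.snoc (α := fun _ => M) (fun i => a i.castSucc) (a (Fin.last n)) = a from
        Fin.snoc_init_self a]

end Semantics

/-! ### The second-order formula that expresses the existence of a coding -/

/-- `z = {x, y}` -/
def isPair (z x y : Fin n) : SOFm m n :=
  allS fun u => (SOFm.mem u z↗).iff ((SOFm.eq u x↗).or (.eq u y↗))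

/-- `p = (x, y)` -/
def isOPair (p x y : Fin n) : SOFm m n :=
  allS fun z => (SOFm.mem z p↗).iff ((isPair z x↗ x↗).or (isPair z x↗ y↗))

/-- `(x, y) ∈ X` -/
def rel (X : Fin m) (x y : Fin n) : SOFm m n := exS fun p => (isOPair p x↗ y↗).and (.app X p)

/-- `x` and `y` have the same predecessors with respect to `X`. -/
def samePreds (X : Fin m) (x y : Fin n) : SOFm m n := allS fun z => (rel X z x↗).iff (rel X z y↗)

/-- `p = (∅, x)` -/
def isBase (p x : Fin n) : SOFm m n :=
  exS fun e => (allS fun z => (SOFm.mem z e↗).not).and (isOPair p↗ e x↗)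

/-- The predecessors of `a` with respect to `X` are the codes of the elements given by `φ`. -/
def isCodeOf (X : Fin m) (a : Fin n) (φ : Fin (n + 2) → SOFm m (n + 2)) : SOFm m n :=
  allS fun z => (rel X z a↗).iff
    (exS fun x => (φ x).and (exS fun r => (isBase r x↗).and (samePreds X z↗↗ r)))

/-- If `Y` is nonempty, it has a minimal element with respect to `X`. -/
def hasMinimal (X Y : Fin m) : SOFm m n :=
  (exS fun u => .app Y u).imp
    (exS fun u => (SOFm.app Y u).and (allS fun v => (SOFm.app Y v).imp (rel X v u↗).not))

/-- The translation of a first-order formula, with `∈` interpreted by `rel X` and `=` interpreted by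
`samePreds X`. -/
def translate (X : Fin m) : {n : ℕ} → Fm n → SOFm m n
  | _, .falsum => .falsum
  | _, .equal s t => samePreds X (termVar s) (termVar t)
  | _, .rel .mem ts => rel X (termVar (ts 0)) (termVar (ts 1))
  | _, .imp φ ψ => (translate X φ).imp (translate X ψ)
  | _, .all φ => (translate X φ).all₁
where
  /-- The variable that a term is. -/
  termVar {n : ℕ} : setLang.Term (Empty ⊕ Fin n) → Fin n
    | .var (.inl x) => x.elim
    | .var (.inr x) => x
    | .func f _ => (f : Empty).elim

/-- The first-order part of the translation of a `Σ₁`-formula, with second-order variables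
`A₀, …, Aₖ₋₁, X, Y`. -/
def matrix (φ : Fm k) : SOFm (k + 2) 0 :=
  let X : Fin (k + 2) := (Fin.last k).castSucc
  let Y : Fin (k + 2) := Fin.last (k + 1)
  (hasMinimal X Y).and
    ((allS fun x => allS fun x' => allS fun y =>
      (samePreds X x↗↗ x'↗).imp ((rel X x↗↗ y).imp (rel X x'↗ y))).and
    ((allS fun y => allS fun q => (isBase q y↗).imp (isCodeOf X q fun x => .mem x y↗↗↗)).and
    (exs ((conj ((List.finRange k).map fun i =>
      isCodeOf X i fun x => .app i.castSucc.castSucc x)).and (translate X φ)))))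

section NoSOQuant

theorem NoSOQuant.isPair (z x y : Fin n) : (isPair z x y : SOFm m n).NoSOQuant :=
  .allS fun _ => .iff (.mem _ _) (.or (.eq _ _) (.eq _ _))

theorem NoSOQuant.isOPair (p x y : Fin n) : (isOPair p x y : SOFm m n).NoSOQuant :=
  .allS fun _ => .iff (.mem _ _) (.or (.isPair _ _ _) (.isPair _ _ _))

theorem NoSOQuant.rel (X : Fin m) (x y : Fin n) : (rel X x y).NoSOQuant :=
  .exS fun _ => .and (.isOPair _ _ _) (.app _ _)

theorem NoSOQuant.samePreds (X : Fin m) (x y : Fin n) : (samePreds X x y).NoSOQuant :=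
  .allS fun _ => .iff (.rel _ _ _) (.rel _ _ _)

theorem NoSOQuant.isBase (p x : Fin n) : (isBase p x : SOFm m n).NoSOQuant :=
  .exS fun _ => .and (.allS fun _ => .not (.mem _ _)) (.isOPair _ _ _)

theorem NoSOQuant.isCodeOf (X : Fin m) (a : Fin n) {φ : Fin (n + 2) → SOFm m (n + 2)}
    (h : ∀ x, (φ x).NoSOQuant) : (isCodeOf X a φ).NoSOQuant :=
  .allS fun _ => .iff (.rel _ _ _) (.exS fun x => .and (h x) (.exS fun _ =>
    .and (.isBase _ _) (.samePreds _ _ _)))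

theorem NoSOQuant.hasMinimal (X Y : Fin m) : (hasMinimal X Y : SOFm m n).NoSOQuant :=
  .imp (.exS fun _ => .app _ _) (.exS fun _ => .and (.app _ _) (.allS fun _ =>
    .imp (.app _ _) (.not (.rel _ _ _))))

theorem NoSOQuant.translate (X : Fin m) (φ : Fm n) : (translate X φ).NoSOQuant := by
  induction φ using Fm.induction with
  | falsum => exact .falsum
  | eq x y => exact .samePreds _ _ _
  | mem x y => exact .rel _ _ _
  | imp φ ψ h1 h2 => exact .imp h1 h2
  | all φ h => exact .all₁ h

theorem NoSOQuant.matrix (φ : Fm k) : (matrix φ).NoSOQuant :=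
  .and (.hasMinimal _ _) (.and (.allS fun _ => .allS fun _ => .allS fun _ =>
    .imp (.samePreds _ _ _) (.imp (.rel _ _ _) (.rel _ _ _))) (.and (.allS fun _ => .allS fun _ =>
    .imp (.isBase _ _) (.isCodeOf _ _ fun _ => .mem _ _)) (.exs (.and (.conj fun ψ h => by
      obtain ⟨i, -, rfl⟩ := List.mem_map.1 h
      exact .isCodeOf _ _ fun _ => .app _ _) (.translate _ _)))))

end NoSOQuant

section Semantics

variable {M : Type} [setLang.Structure M] [hM : M ⊨ ZFC] {D : M} {A : Fin m → M} {a : Fin n → M}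

/-- Quantification over `D` suffices: by transitivity the elements of `a z` lie in `D`, as do `a x`
and `a y`. -/
theorem sem_isPair (hD : IsPairClosed D) (ha : ∀ i, a i ∈' D) {z x y : Fin n} :
    (isPair z x y).Sem D A a ↔ a z = upair (a x) (a y) := by
  simp only [isPair, sem_allS, sem_iff, sem_mem, sem_or, sem_eq, Fin.snoc_last, Fin.snoc_castSucc]
  refine ⟨fun h => ext fun u => ?_, fun h u _ => by rw [h, mem_upair]⟩
  rw [mem_upair]
  by_cases hu : u ∈' D
  · exact h u hu
  · refine iff_of_false (fun h => hu (hD.trans _ _ (ha z) h)) ?_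
    rintro (rfl | rfl)
    · exact hu (ha x)
    · exact hu (ha y)

/-- Closure under pairs puts `{a x}` and `{a x, a y}` in the range of the quantifier. -/
theorem sem_isOPair (hD : IsPairClosed D) (ha : ∀ i, a i ∈' D) {p x y : Fin n} :
    (isOPair p x y).Sem D A a ↔ a p = opair (a x) (a y) := by
  simp only [isOPair, sem_allS, sem_iff, sem_mem, sem_or, Fin.snoc_last, Fin.snoc_castSucc]
  have key : ∀ u, u ∈' D → ∀ v w : Fin n, (isPair (Fin.last n) v↗ w↗).Sem D A
      (Fin.snoc (α := fun _ => M) a u) ↔ u = upair (a v) (a w) := fun u hu v w => by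
    rw [sem_isPair hD (forall_snoc (P := fun x => x ∈' D) ha hu)]
    simp only [Fin.snoc_last, Fin.snoc_castSucc]
  constructor
  · refine fun h => ext fun u => ?_
    rw [opair, mem_upair]
    by_cases hu : u ∈' D
    · rw [h u hu, key u hu, key u hu]
    · refine iff_of_false (fun h => hu (hD.trans _ _ (ha p) h)) ?_
      rintro (rfl | rfl)
      · exact hu (hD.upair_mem _ _ (ha x) (ha x))
      · exact hu (hD.upair_mem _ _ (ha x) (ha y))
  · intro h u hu
    rw [h, opair, mem_upair, key u hu, key u hu]

theorem sem_rel (hD : IsPairClosed D) (ha : ∀ i, a i ∈' D) {X : Fin m} {x y : Fin n} :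
    (rel X x y).Sem D A a ↔ opair (a x) (a y) ∈' A X := by
  simp only [rel, sem_exS, sem_and, sem_app]
  constructor
  · rintro ⟨p, hp, h, hpX⟩
    rw [sem_isOPair hD (forall_snoc (P := fun x => x ∈' D) ha hp)] at h
    simp only [Fin.snoc_last, Fin.snoc_castSucc] at h hpX
    rwa [← h]
  · intro h
    have hp := hD.opair_mem (ha x) (ha y)
    refine ⟨_, hp, ?_⟩
    rw [sem_isOPair hD (forall_snoc (P := fun x => x ∈' D) ha hp)]
    simp only [Fin.snoc_last, Fin.snoc_castSucc]
    exact ⟨trivial, h⟩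

theorem sem_samePreds (hD : IsPairClosed D) (ha : ∀ i, a i ∈' D) {X : Fin m} {x y : Fin n} :
    (samePreds X x y).Sem D A a ↔ SamePreds D (fun u v => opair u v ∈' A X) (a x) (a y) := by
  simp only [samePreds, sem_allS, sem_iff, SamePreds]
  refine forall₂_congr fun z hz => ?_
  rw [sem_rel hD (forall_snoc (P := fun x => x ∈' D) ha hz),
    sem_rel hD (forall_snoc (P := fun x => x ∈' D) ha hz)]
  simp only [Fin.snoc_last, Fin.snoc_castSucc]

theorem sem_isBase (hD : IsPairClosed D) (ha : ∀ i, a i ∈' D) {p x : Fin n} :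
    (isBase p x).Sem D A a ↔ a p = opair (empty M) (a x) := by
  have key : ∀ e, e ∈' D → ((allS fun z => (SOFm.mem z (Fin.last n)↗).not).Sem D A
      (Fin.snoc (α := fun _ => M) a e) ↔ e = empty M) := fun e he => by
    simp only [sem_allS, sem_not, sem_mem, Fin.snoc_last, Fin.snoc_castSucc, eq_empty_iff]
    exact ⟨fun h y hy => h y (hD.trans _ _ he hy) hy, fun h y _ => h y⟩
  simp only [isBase, sem_exS, sem_and]
  constructor
  · rintro ⟨e, he, h1, h2⟩
    rw [sem_isOPair hD (forall_snoc (P := fun x => x ∈' D) ha he)] at h2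
    simp only [Fin.snoc_last, Fin.snoc_castSucc] at h2
    rw [h2, (key e he).1 h1]
  · intro h
    refine ⟨_, hD.empty_mem, (key _ hD.empty_mem).2 rfl, ?_⟩
    rw [sem_isOPair hD (forall_snoc (P := fun x => x ∈' D) ha hD.empty_mem)]
    simpa only [Fin.snoc_last, Fin.snoc_castSucc] using h

/-- The formula `φ` defining `B` on `D` is left open, to cover both elements of `D` and values of
second-order variables. -/
theorem sem_isCodeOf (hD : IsPairClosed D) (ha : ∀ i, a i ∈' D) {X : Fin m} {x : Fin n}
    {φ : Fin (n + 2) → SOFm m (n + 2)} {B : M}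
    (hφ : ∀ z x, z ∈' D → x ∈' D → ((φ (Fin.last (n + 1))).Sem D A
      (Fin.snoc (α := fun _ => M) (Fin.snoc (α := fun _ => M) a z) x) ↔ x ∈' B)) :
    (isCodeOf X x φ).Sem D A a ↔ IsCodeOf D (fun u v => opair u v ∈' A X) (a x) B := by
  simp only [isCodeOf, sem_allS, sem_iff, sem_exS, sem_and, IsCodeOf]
  refine forall₂_congr fun z hz => ?_
  have hz' := forall_snoc (P := fun x => x ∈' D) ha hz
  rw [sem_rel hD hz']
  simp only [Fin.snoc_last, Fin.snoc_castSucc]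
  refine iff_congr Iff.rfl (exists_congr fun y => and_congr_right fun hy => ?_)
  rw [hφ z y hz hy]
  refine and_congr_right fun _ => ?_
  have hy' := forall_snoc (P := fun x => x ∈' D) hz' hy
  constructor
  · rintro ⟨r, hr, h1, h2⟩
    rw [sem_isBase hD (forall_snoc (P := fun x => x ∈' D) hy' hr)] at h1
    rw [sem_samePreds hD (forall_snoc (P := fun x => x ∈' D) hy' hr)] at h2
    simp only [Fin.snoc_last, Fin.snoc_castSucc] at h1 h2
    rwa [← h1]
  · intro h
    have hr := hD.opair_mem hD.empty_mem hy
    refine ⟨_, hr, ?_⟩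
    rw [sem_isBase hD (forall_snoc (P := fun x => x ∈' D) hy' hr),
      sem_samePreds hD (forall_snoc (P := fun x => x ∈' D) hy' hr)]
    simp only [Fin.snoc_last, Fin.snoc_castSucc]
    exact ⟨trivial, h⟩

theorem sem_hasMinimal (hD : IsPairClosed D) (ha : ∀ i, a i ∈' D) {X Y : Fin m} (hY : A Y ⊆' D) :
    (hasMinimal X Y).Sem D A a ↔ ((∃ y, y ∈' A Y) →
      ∃ u, u ∈' A Y ∧ ∀ v, v ∈' A Y → ¬ opair v u ∈' A X) := by
  simp only [hasMinimal, sem_imp, sem_exS, sem_and, sem_app, sem_allS, sem_not, Fin.snoc_last]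
  refine imp_congr ⟨fun ⟨y, _, h⟩ => ⟨y, h⟩, fun ⟨y, h⟩ => ⟨y, hY y h, h⟩⟩ ?_
  have key : ∀ u, u ∈' D → ∀ v, v ∈' D → ((rel X (Fin.last (n + 1)) (Fin.last n)↗).Sem D A
      (Fin.snoc (α := fun _ => M) (Fin.snoc (α := fun _ => M) a u) v) ↔ opair v u ∈' A X) :=
    fun u hu v hv => by
      rw [sem_rel hD (forall_snoc (P := fun x => x ∈' D)
        (forall_snoc (P := fun x => x ∈' D) ha hu) hv)]
      simp only [Fin.snoc_last, Fin.snoc_castSucc]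
  constructor
  · rintro ⟨u, hu, huY, h⟩
    exact ⟨u, huY, fun v hv hR => h v (hY v hv) hv ((key u hu v (hY v hv)).2 hR)⟩
  · rintro ⟨u, huY, h⟩
    exact ⟨u, hY u huY, huY, fun v hvD hv hR => h v hv ((key u (hY u huY) v hvD).1 hR)⟩

theorem sem_translate (hD : IsPairClosed D) {X : Fin m} (φ : Fm n) (a : Fin n → M)
    (ha : ∀ i, a i ∈' D) : (translate X φ).Sem D A a ↔
      Sat (· ∈' D) (fun u v => opair u v ∈' A X) (SamePreds D fun u v => opair u v ∈' A X) φ a := by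
  induction φ using Fm.induction with
  | falsum => exact Iff.rfl
  | eq x y => exact sem_samePreds hD ha
  | mem x y => exact sem_rel hD ha
  | imp φ ψ h1 h2 => exact imp_congr (h1 a ha) (h2 a ha)
  | all φ h =>
    exact forall₂_congr fun x hx => h _ (forall_snoc (P := fun x => x ∈' D) ha hx)

/-- Quantifying over `Y` turns `hasMinimal` into well-foundedness in the sense of the model; the
other conjuncts are independent of `Y`. -/
theorem sem_matrix (hD : IsPairClosed D) (φ : Fm k) (A : Fin k → M) (X : M) :
    (matrix φ).all₂.Sem D (Fin.snoc (α := fun _ => M) A X) Fin.elim0 ↔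
      IsCoding D (fun u v => opair u v ∈' X) ∧ ∃ a : Fin k → M, (∀ i, a i ∈' D) ∧
        (∀ i, IsCodeOf D (fun u v => opair u v ∈' X) (a i) (A i)) ∧
        Sat (· ∈' D) (fun u v => opair u v ∈' X) (SamePreds D fun u v => opair u v ∈' X) φ a := by
  let R : M → M → Prop := fun u v => opair u v ∈' X
  have h0 : ∀ i, (Fin.elim0 : Fin 0 → M) i ∈' D := fun i => i.elim0
  have hmin : ∀ Y, Y ⊆' D → _ := fun Y hY => sem_hasMinimal (X := (Fin.last k).castSucc)
    (Y := Fin.last (k + 1))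
    (A := Fin.snoc (α := fun _ => M) (Fin.snoc (α := fun _ => M) A X) Y) hD h0 (by simpa only [Fin.snoc_last] using hY)
  have hcongr : ∀ Y, (allS fun x => allS fun x' => allS fun y =>
      (samePreds (Fin.last k).castSucc x↗↗ x'↗).imp ((rel (Fin.last k).castSucc x↗↗ y).imp
        (rel (Fin.last k).castSucc x'↗ y))).Sem D
      (Fin.snoc (α := fun _ => M) (Fin.snoc (α := fun _ => M) A X) Y) Fin.elim0 ↔
      ∀ x x' y, x ∈' D → x' ∈' D → y ∈' D → SamePreds D R x x' → R x y → R x' y := fun Y => by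
    simp only [sem_allS, sem_imp]
    have key : ∀ x x' y, x ∈' D → x' ∈' D → y ∈' D → _ := fun x x' y hx hx' hy =>
      forall_snoc (P := fun x => x ∈' D) (forall_snoc (P := fun x => x ∈' D)
        (forall_snoc (P := fun x => x ∈' D) h0 hx) hx') hy
    constructor
    · intro h x x' y hx hx' hy
      have := h x hx x' hx' y hy
      rw [sem_samePreds hD (key x x' y hx hx' hy), sem_rel hD (key x x' y hx hx' hy),
        sem_rel hD (key x x' y hx hx' hy)] at this
      simpa only [Fin.snoc_last, Fin.snoc_castSucc] using this
    · intro h x hx x' hx' y hy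
      rw [sem_samePreds hD (key x x' y hx hx' hy), sem_rel hD (key x x' y hx hx' hy),
        sem_rel hD (key x x' y hx hx' hy)]
      simpa only [Fin.snoc_last, Fin.snoc_castSucc] using h x x' y hx hx' hy
  have hbase : ∀ Y, (allS fun y => allS fun q => (isBase q y↗).imp
      (isCodeOf (Fin.last k).castSucc q fun x => .mem x y↗↗↗)).Sem D
      (Fin.snoc (α := fun _ => M) (Fin.snoc (α := fun _ => M) A X) Y) Fin.elim0 ↔
      ∀ y, y ∈' D → IsCodeOf D R (opair (empty M) y) y := fun Y => by
    simp only [sem_allS, sem_imp]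
    refine forall₂_congr fun y hy => ?_
    have key : ∀ q, q ∈' D → _ := fun q hq =>
      forall_snoc (P := fun x => x ∈' D) (forall_snoc (P := fun x => x ∈' D) h0 hy) hq
    have key2 : ∀ q, q ∈' D → _ := fun q hq => sem_isCodeOf (X := (Fin.last k).castSucc)
      (x := Fin.last 1) (φ := fun x => .mem x (Fin.last 0)↗↗↗) (B := y)
      (A := Fin.snoc (α := fun _ => M) (Fin.snoc (α := fun _ => M) A X) Y) hD (key q hq)
      (fun z x hz hx => by simp only [sem_mem, Fin.snoc_last, Fin.snoc_castSucc])
    constructor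
    · intro h
      have hq := hD.opair_mem hD.empty_mem hy
      have := h _ hq (by
        rw [sem_isBase hD (key _ hq)]
        simp only [Fin.snoc_last, Fin.snoc_castSucc])
      rw [key2 _ hq] at this
      simpa only [Fin.snoc_last, Fin.snoc_castSucc] using this
    · intro h q hq hqb
      rw [sem_isBase hD (key _ hq)] at hqb
      rw [key2 _ hq]
      simp only [Fin.snoc_last, Fin.snoc_castSucc] at hqb ⊢
      rw [hqb]
      exact h
  have hex : ∀ Y, (exs ((conj ((List.finRange k).map fun i =>
      isCodeOf (Fin.last k).castSucc i fun x => .app i.castSucc.castSucc x)).and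
        (translate (Fin.last k).castSucc φ))).Sem D
      (Fin.snoc (α := fun _ => M) (Fin.snoc (α := fun _ => M) A X) Y) Fin.elim0 ↔
      ∃ a : Fin k → M, (∀ i, a i ∈' D) ∧ (∀ i, IsCodeOf D R (a i) (A i)) ∧
        Sat (· ∈' D) R (SamePreds D R) φ a := fun Y => by
    rw [sem_exs]
    refine exists_congr fun a => and_congr_right fun ha => ?_
    rw [sem_and, sem_conj, sem_translate hD φ a ha]
    simp only [List.forall_mem_map, List.mem_finRange, forall_const, Fin.snoc_last,
      Fin.snoc_castSucc]
    refine and_congr_left fun _ => forall_congr' fun i => ?_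
    rw [sem_isCodeOf (B := A i) hD ha fun z x _ _ => by
      simp only [sem_app, Fin.snoc_last, Fin.snoc_castSucc] ]
    simp only [Fin.snoc_last, Fin.snoc_castSucc, R]
  simp only [Fin.snoc_last, Fin.snoc_castSucc] at hmin
  simp only [sem_all₂, matrix, sem_and, hcongr, hbase, hex]
  constructor
  · intro h
    -- The conjuncts without `Y` are read off from the instance `Y = ∅`.
    obtain ⟨-, h2, h3, h4⟩ := h (empty M) fun z hz => (not_mem_empty hz).elim
    exact ⟨⟨fun Y hY hne => (hmin Y hY).1 (h Y hY).1 hne, h2, h3⟩, h4⟩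
  · rintro ⟨h1, h4⟩ Y hY
    exact ⟨(hmin Y hY).2 (h1.wf Y hY), h1.congr, h1.base, h4⟩

end Semantics

end SOFm

/-! ### `V_λ` in a model of set theory -/

section Hierarchy

variable {M : Type} [setLang.Structure M]

/-- `x` is an ordinal. -/
structure IsOrd (x : M) : Prop where
  trans : ∀ y, y ∈' x → y ⊆' x
  trichotomy : ∀ y, y ∈' x → ∀ z, z ∈' x → y ∈' z ∨ y = z ∨ z ∈' y

theorem realize_isOrd {v : Empty → M} {xs : Fin n → M} {x : Fin n} :
    (isOrd x).Realize v xs ↔ IsOrd (xs x) := by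
  simp only [isOrd, isTransitive, realize_ballF, realize_subset, realize_mem, realize_eq,
    Language.BoundedFormula.realize_inf, Language.BoundedFormula.realize_sup, Fin.snoc_last,
    Fin.snoc_castSucc]
  exact ⟨fun h => ⟨h.1, h.2⟩, fun h => ⟨h.1, h.2⟩⟩

/-- `f` is a function from `x` to `y`. -/
structure IsFun [M ⊨ ZFC] (f x y : M) : Prop where
  subset : ∀ p, p ∈' f → ∃ a, a ∈' x ∧ ∃ b, b ∈' y ∧ p = opair a b
  value : ∀ a, a ∈' x → ∃ b, ∀ c, opair a c ∈' f ↔ c = b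

/-- There is a function from `x` to `l` with cofinal range. -/
def HasCofinalMap [M ⊨ ZFC] (x l : M) : Prop :=
  ∃ f, IsFun f x l ∧ ∀ b, b ∈' l → ∃ a, a ∈' x ∧ ∃ c, c ∈' l ∧ opair a c ∈' f ∧ b ⊆' c

variable [hM : M ⊨ ZFC] {v : Empty → M} {xs : Fin n → M}

theorem realize_pairMem' {f x y : Fin n} :
    (pairMem f x y).Realize v xs ↔ opair (xs x) (xs y) ∈' xs f := by
  simp only [realize_pairMem, isOPair_iff, exists_eq_right]

theorem realize_isFun {f x y : Fin n} :
    (isFun f x y).Realize v xs ↔ IsFun (xs f) (xs x) (xs y) := by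
  simp only [isFun, realize_ballF, realize_bexF, realize_exF, realize_allF, realize_isOPair,
    isOPair_iff, realize_pairMem', Language.BoundedFormula.realize_iff, realize_eq,
    Language.BoundedFormula.realize_inf, Fin.snoc_last, Fin.snoc_castSucc]
  exact ⟨fun h => ⟨h.1, h.2⟩, fun h => ⟨h.1, h.2⟩⟩

theorem realize_hasCofinalMap {x l : Fin n} :
    (hasCofinalMap x l).Realize v xs ↔ HasCofinalMap (xs x) (xs l) := by
  simp only [hasCofinalMap, HasCofinalMap, realize_ballF, realize_bexF, realize_exF, realize_isFun,
    realize_pairMem', realize_subset, Language.BoundedFormula.realize_inf, Fin.snoc_last,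
    Fin.snoc_castSucc]

theorem IsOrd.subset_of_mem {l a b : M} (hl : IsOrd l) (hb : b ∈' l) (hab : a ∈' b) : a ⊆' b := by
  intro c hc
  have ha := hl.trans b hb a hab
  rcases hl.trichotomy c (hl.trans a ha c hc) b hb with h | h | h
  · exact h
  · exact (mem_asymm hab (h ▸ hc)).elim
  · exact (mem_asymm₃ h hc hab).elim

/-- An ordinal of cofinality `ω` has no largest element. -/
theorem IsOrd.exists_gt {l w : M} (hl : IsOrd l) (hw : IsLinearLimit w)
    (hcof : ∀ b, b ∈' w → ¬ HasCofinalMap b l) (b : M) (hb : b ∈' l) : ∃ c, c ∈' l ∧ b ∈' c := by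
  by_contra hn
  obtain ⟨i, hi⟩ := hw.nonempty
  obtain ⟨j, hj, hij⟩ := hw.exists_gt i hi
  -- If `b` were largest, the constant function with value `b` on the nonempty `j ∈ w` would have
  -- cofinal range.
  refine hcof j hj ⟨image j fun a => opair a b, ⟨fun p hp => ?_, fun a ha => ⟨b, fun c => ?_⟩⟩,
    fun c hc => ⟨i, hij, b, hb, mem_image.2 ⟨i, hij, rfl⟩, ?_⟩⟩
  · obtain ⟨a, ha, rfl⟩ := mem_image.1 hp
    exact ⟨a, ha, b, hb, rfl⟩
  · simp only [mem_image, opair_inj]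
    constructor
    · rintro ⟨_, _, _, rfl⟩
      rfl
    · rintro rfl
      exact ⟨a, ha, rfl, rfl⟩
  · rcases hl.trichotomy b hb c hc with h | rfl | h
    · exact (hn ⟨c, hc, h⟩).elim
    · exact fun _ h => h
    · exact hl.subset_of_mem hb h

/-- `V_l` is closed under pairs if `l` is a limit ordinal. -/
theorem isPairClosed_of_hierarchy {l D f r : M} (hl : IsOrd l) (hne : ∃ a, a ∈' l)
    (hlim : ∀ b, b ∈' l → ∃ c, c ∈' l ∧ b ∈' c) (hf : IsFun f l r)
    (hrec : ∀ a, a ∈' l → ∃ u, opair a u ∈' f ∧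
      ∀ x, x ∈' u ↔ ∃ b, b ∈' a ∧ ∃ v, opair b v ∈' f ∧ x ⊆' v)
    (hD : ∀ x, x ∈' D ↔ ∃ b, b ∈' l ∧ ∃ v, opair b v ∈' f ∧ x ⊆' v) : IsPairClosed D := by
  choose! F hF using hf.value
  have hFf : ∀ a, a ∈' l → opair a (F a) ∈' f := fun a ha => (hF a ha _).2 rfl
  have hFrec : ∀ a, a ∈' l → ∀ x, x ∈' F a ↔ ∃ b, b ∈' a ∧ x ⊆' F b := fun a ha x => by
    obtain ⟨u, hu, h⟩ := hrec a ha
    obtain rfl := (hF a ha u).1 hu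
    rw [h]
    refine exists_congr fun b => and_congr_right fun hb => ?_
    have hbl := hl.trans a ha b hb
    simp only [hF b hbl, exists_eq_left]
  have hFD : ∀ x, x ∈' D ↔ ∃ b, b ∈' l ∧ x ⊆' F b := fun x => by
    rw [hD]
    refine exists_congr fun b => and_congr_right fun hb => ?_
    simp only [hF b hb, exists_eq_left]
  have hmono : ∀ a b, b ∈' l → a ∈' b → F a ⊆' F b := fun a b hb hab x hx => by
    obtain ⟨c, hc, h⟩ := (hFrec a (hl.trans b hb a hab) x).1 hx
    exact (hFrec b hb x).2 ⟨c, hl.subset_of_mem hb hab c hc, h⟩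
  refine ⟨fun y z hy hz => ?_, ?_, fun x y hx hy => ?_⟩
  · obtain ⟨b, hb, hyb⟩ := (hFD y).1 hy
    obtain ⟨c, hc, h⟩ := (hFrec b hb z).1 (hyb z hz)
    exact (hFD z).2 ⟨c, hl.trans b hb c hc, h⟩
  · obtain ⟨a, ha⟩ := hne
    exact (hFD _).2 ⟨a, ha, fun z hz => (not_mem_empty hz).elim⟩
  · obtain ⟨b, hb, hxb⟩ := (hFD x).1 hx
    obtain ⟨c, hc, hyc⟩ := (hFD y).1 hy
    have : ∃ d, d ∈' l ∧ x ⊆' F d ∧ y ⊆' F d := by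
      rcases hl.trichotomy b hb c hc with h | rfl | h
      · exact ⟨c, hc, fun z hz => hmono b c hc h z (hxb z hz), hyc⟩
      · exact ⟨b, hb, hxb, hyc⟩
      · exact ⟨b, hb, hxb, fun z hz => hmono c b hb h z (hyc z hz)⟩
    obtain ⟨d, hd, hxd, hyd⟩ := this
    -- From `x, y ⊆ F d` with `d ∈ e` follows `x, y ∈ F e`, so `{x, y} ⊆ F e`; this is where the
    -- limit hypothesis enters.
    obtain ⟨e, he, hde⟩ := hlim d hd
    refine (hFD _).2 ⟨e, he, fun z hz => (hFrec e he z).2 ⟨d, hde, ?_⟩⟩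
    rcases mem_upair.1 hz with rfl | rfl
    · exact hxd
    · exact hyd

/-- Cofinality `ω` makes `l` a limit ordinal, so that `D = V_l` is pair-closed, and provides the
linear order `w`. The two implications are then `IsPairClosed.exists_coding` and
`IsCoding.realize_of_sat`. -/
theorem realize_translationSentence (φ : Fm k) (hφ : IsSigma1 φ) :
    M ⊨ translationSentence φ (SOFm.matrix φ).all₂.ex₂ := by
  refine (Language.BoundedFormula.realize_alls (v := (default : Empty → M))).2 fun A => ?_
  simp only [realize_allF, Language.BoundedFormula.realize_imp, Language.BoundedFormula.realize_inf,
    Language.BoundedFormula.realize_iff, Language.BoundedFormula.realize_iInf, realize_rename',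
    SOFm.realize_sat, realize_subset, isSingular, isInfCard, hasCofOmega, isOmega, isLimit, isCof,
    isV, realize_isOrd, realize_hasCofinalMap, realize_isFun, realize_exF, realize_bexF,
    realize_ballF, realize_mem, realize_pairMem', Language.BoundedFormula.realize_not,
    Fin.snoc_last, Fin.snoc_castSucc]
  rintro l D ⟨⟨⟨⟨hl, -⟩, -⟩, w, ⟨⟨hw, hwne, hwlim⟩, -⟩, -, ⟨g, hg, -⟩, hcof⟩,
    ⟨⟨f, ⟨r, hf⟩, hrec, hD⟩, -⟩, hA⟩
  have hw' : IsLinearLimit w := ⟨hwne, fun i j hi hj => hw.trichotomy i hi j hj, hwlim⟩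
  have hV : IsPairClosed D := by
    refine isPairClosed_of_hierarchy hl ?_ (fun b hb => hl.exists_gt hw' hcof b hb) hf hrec hD
    obtain ⟨i, hi⟩ := hwne
    obtain ⟨b, hb⟩ := hg.value i hi
    obtain ⟨_, -, c, hc, -⟩ := hg.subset _ ((hb b).2 rfl)
    exact ⟨c, hc⟩
  have h0 : ∀ a : Fin 0 → M, a = Fin.elim0 := fun a => Subsingleton.elim _ _
  rw [SOFm.sem_ex₂]
  simp only [h0, SOFm.sem_matrix hV]
  constructor
  · intro h
    exact hV.exists_coding hw' hφ h hA
  · rintro ⟨X, -, hX, a, ha, hcode, hs⟩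
    exact hX.realize_of_sat inferInstance hV hφ hA ha hcode hs

end Hierarchy

end LST

/-- Every `Σ₁`-formula `φ` has a `Σ¹₂`-formula `ψ` such that ZFC proves that `φ(A₀, …, Aₖ₋₁)` is
equivalent to `⟨V_λ, ∈⟩ ⊨ ψ(A₀, …, Aₖ₋₁)` for all singular cardinals `λ` of countable cofinality
with `H(λ) = V_λ` and all `A₀, …, Aₖ₋₁ ∈ V_{λ+1}`. -/
theorem mainTheorem9 (k : ℕ) (φ : LST.Fm k) (hφ : LST.IsSigma1 φ) :
    ∃ ψ : LST.SOFm k 0, ψ.IsSigma12 ∧ LST.Proves LST.ZFC (LST.translationSentence φ ψ) := by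
  refine ⟨_, ⟨LST.SOFm.matrix φ, .matrix φ, rfl⟩, ?_⟩
  -- The axiom of infinity is the existential sentence that `Proves.of_models` requires.
  obtain ⟨θ, hθ⟩ : ∃ θ : LST.Fm 1, LST.infinity = θ.ex := ⟨_, rfl⟩
  have h : LST.infinity ∈ LST.ZFC := .inl (.inl (by simp))
  exact LST.Proves.of_models (hθ ▸ h) fun M _ _ => LST.realize_translationSentence φ hφ
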